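/- For $f:\mathbb{N}\to\mathbb{N}$, the Ramsey quantifier $\mathsf{R}_f$ is the class of all finite models $(M,S)$, with $S\subseteq M\times M$ a binary relation, for which there is a set $A\subseteq M$ with $|A|\ge f(|M|)$ such that $S(a,b)$ holds for all $a,b\in A$ (including $a=b$). The function $f$ is *constant-log-bounded* if there is a constant $c\in\mathbb{N}$ such that for all sufficiently large $n$ we have $f(n)\le c$ or $f(n)\ge n-c\log_2 n$. The function $f$ is *polynomial-time computable* if some Turing machine computes $f(n)$ (written in binary) in time polynomial in $n$, i.e. with $n$ given in unary. The quantifier $\mathsf{R}_f$ is *polynomial-time computable* if some Turing machine decides, in time polynomial in the length of the encoding of a finite model $(M,S)$ as a string (size in unary followed by the adjacency matrix), whether $(M,S)\in\mathsf{R}_f$. **Statement.** If $f:\mathbb{N}\to\mathbb{N}$ is polynomial-time computable and constant-log-bounded, then the Ramsey quantifier $\mathsf{R}_f$ is polynomial-time computable. -/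

import Mathlib

open Filter

/-- A generalized quantifier of type `(2)` on finite models: a class of finite models `(M, S)` with
one binary relation `S`, closed under isomorphism. -/
structure BinaryQuantifier where
  /-- `Mem M S` says that the finite model `(M, S)` belongs to the class. -/
  Mem : (M : Type) → [Fintype M] → (M → M → Prop) → Prop
  iso_closed : ∀ (M N : Type) [Fintype M] [Fintype N] (S : M → M → Prop) (T : N → N → Prop)
    (e : M ≃ N), (∀ a b, S a b ↔ T (e a) (e b)) → (Mem M S ↔ Mem N T)

/-- A subset `A` of a finite universe `U` is `f`-large relatively to `U`: `|A| ≥ f(|U|)`. -/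
def IsLarge (f : ℕ → ℕ) {U : Type} [Fintype U] (A : Finset U) : Prop :=
  f (Fintype.card U) ≤ A.card

/-- `(M, S)` has an `f`-large set `A ⊆ M` with `S a b` for all `a, b ∈ A` (including `a = b`). -/
def RamseyMem (f : ℕ → ℕ) (M : Type) [Fintype M] (S : M → M → Prop) : Prop :=
  ∃ A : Finset M, IsLarge f A ∧ ∀ a ∈ A, ∀ b ∈ A, S a b

theorem RamseyMem.of_iso {f : ℕ → ℕ} {M N : Type} [Fintype M] [Fintype N]
    {S : M → M → Prop} {T : N → N → Prop} (e : M ≃ N) (h : ∀ a b, S a b ↔ T (e a) (e b))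
    (hM : RamseyMem f M S) : RamseyMem f N T := by
  obtain ⟨A, hA, hS⟩ := hM
  refine ⟨A.map e.toEmbedding, ?_, ?_⟩
  · simpa [IsLarge, Fintype.card_congr e] using hA
  · intro a ha b hb
    obtain ⟨a', ha', rfl⟩ := Finset.mem_map.1 ha
    obtain ⟨b', hb', rfl⟩ := Finset.mem_map.1 hb
    exact (h a' b').1 (hS a' ha' b' hb')

/-- The Ramsey quantifier `R_f`. -/
def ramseyQuantifier (f : ℕ → ℕ) : BinaryQuantifier where
  Mem M _ S := RamseyMem f M S
  iso_closed M N _ _ S T e h :=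
    ⟨RamseyMem.of_iso e h, RamseyMem.of_iso e.symm fun a b => by simp [h]⟩

/-- A finite model with universe `{0, …, size - 1}`, its relation given by a Boolean matrix. -/
structure FiniteModel where
  size : ℕ
  rel : Fin size → Fin size → Bool

/-- The standard string encoding of a finite model: its size `n` in unary, a terminating `0`, and
then the `n²` entries of the adjacency matrix, row by row. -/
def FiniteModel.encode (A : FiniteModel) : List Bool :=
  Computability.unaryEncodeNat A.size ++
    false :: (List.finRange A.size).flatMap fun i => (List.finRange A.size).map fun j => A.rel i j

open scoped Classical in
/-- A quantifier is polynomial-time computable if some Turing machine, given the encoding of a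
finite model, decides in polynomial time whether the model belongs to the class. (Every finite model
is isomorphic to one on `{0, …, n - 1}`, and the class is closed under isomorphism.) -/
def BinaryQuantifier.PolyTimeComputable (Q : BinaryQuantifier) : Prop :=
  Nonempty (Turing.TM2ComputableInPolyTime FiniteModel.encode Computability.encodeBool
    fun A : FiniteModel => decide (Q.Mem (Fin A.size) fun a b => A.rel a b = true))

/-- `f` is polynomial-time computable: a Turing machine computes `f n`, written in binary, in time
polynomial in `n`; that is, the input `n` is given in unary. -/
def PolyTimeComputableFun (f : ℕ → ℕ) : Prop :=
  Nonempty (Turing.TM2ComputableInPolyTime Computability.unaryEncodeNat Computability.encodeNat f)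

/-- `f` is constant-log-bounded: there is a constant `c ∈ ℕ` such that for all sufficiently large
`n`, `f n ≤ c` or `f n ≥ n - c log n`. -/
def ConstantLogBounded (f : ℕ → ℕ) : Prop :=
  ∃ c : ℕ, ∀ᶠ n : ℕ in atTop, f n ≤ c ∨ (n : ℝ) - c * Real.logb 2 n ≤ f n

/-! Put `g = min (f n) (n + 1)`; this truncation changes nothing, since no subset of an `n`-element
universe has more than `n` elements. The search for a conflict-free set of size at least `g` is a
branching process on a family of candidate sets. For every pair `(i, j)` outside the relation, each
candidate `v` containing both `i` and `j` is replaced by `v \ {i}` and `v \ {j}`, and candidates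
with fewer than `g` elements are discarded. A candidate left after all pairs is conflict-free
(`of_mem_processRows`). Conversely, a conflict-free set with at least `g` elements that lies in some
initial candidate lies in some candidate at every stage, because it misses `i` or `j`
(`exists_mem_processRows`).

The family stays polynomially small because of the potential `∑ 2 ^ |v|` (`Mask.weight`). A split
turns `2 ^ k` into `2 * 2 ^ (k - 1)`, so the potential never grows (`weight_branch_le`), while each
candidate kept contributes at least `2 ^ g`; hence there are at most potential / `2 ^ g` candidates
(`Good.length_le`). If `g ≤ c`, the start is the family built by `g` insertions into the empty set,
of potential at most `(2 * n) ^ g`, which leaves at most `n ^ g` candidates. Otherwise the start is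
the whole universe, and the bound is `2 ^ (n - g) ≤ n ^ c`, which is the hypothesis `n - c log n ≤ f
n` exponentiated (`two_pow_sub_le`); for `g = n + 1` the size filter leaves nothing.

To obtain an actual machine, the process is written in a small language of stack programs with a
timed big-step semantics `Exec`. Programs compile to `TM2` machines containing the machine for `f`
as a subroutine, and the compiled code respects the time bounds (`reachesIn_of_exec`,
`computableInPolyTime`). The value `f n` may be exponential in `n`, but its binary expansion has
polynomial length (`CallRel.exists_length_le`), so it can be converted to unary with truncation at
`n + 1`. -/

/-! ### Stack programs and their timed semantics -/

/-- The stacks of the programs below. -/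
inductive Stk
  | inp | aux | mark | len | len' | rows | cols | cols' | arg | res | thr | thr' | tmp
  | fro | fro' | one | one' | two | two' | del1 | del2 | buf | buf' | hit1 | hit2 | out
  deriving DecidableEq

instance : Fintype Stk where
  elems := ⟨([.inp, .aux, .mark, .len, .len', .rows, .cols, .cols', .arg, .res, .thr, .thr', .tmp,
    .fro, .fro', .one, .one', .two, .two', .del1, .del2, .buf, .buf', .hit1, .hit2, .out] :
    List Stk), by decide⟩
  complete k := by cases k <;> decide

/-- The contents of all stacks, the top of each stack first. -/
@[ext] structure Store where
  inp : List Bool := []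
  aux : List Bool := []
  mark : List Bool := []
  len : List Bool := []
  len' : List Bool := []
  rows : List Bool := []
  cols : List Bool := []
  cols' : List Bool := []
  arg : List Bool := []
  res : List Bool := []
  thr : List Bool := []
  thr' : List Bool := []
  tmp : List Bool := []
  fro : List Bool := []
  fro' : List Bool := []
  one : List Bool := []
  one' : List Bool := []
  two : List Bool := []
  two' : List Bool := []
  del1 : List Bool := []
  del2 : List Bool := []
  buf : List Bool := []
  buf' : List Bool := []
  hit1 : List Bool := []
  hit2 : List Bool := []
  out : List Bool := []

namespace Store

/-- The contents of a stack. -/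
def get (s : Store) : Stk → List Bool
  | .inp => s.inp | .aux => s.aux | .mark => s.mark | .len => s.len | .len' => s.len'
  | .rows => s.rows | .cols => s.cols | .cols' => s.cols' | .arg => s.arg | .res => s.res
  | .thr => s.thr | .thr' => s.thr' | .tmp => s.tmp | .fro => s.fro
  | .fro' => s.fro' | .one => s.one | .one' => s.one' | .two => s.two | .two' => s.two'
  | .del1 => s.del1 | .del2 => s.del2 | .buf => s.buf | .buf' => s.buf' | .hit1 => s.hit1
  | .hit2 => s.hit2 | .out => s.out

/-- Replace the contents of a stack. -/
def set (s : Store) (k : Stk) (l : List Bool) : Store :=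
  match k with
  | .inp => { s with inp := l } | .aux => { s with aux := l } | .mark => { s with mark := l }
  | .len => { s with len := l } | .len' => { s with len' := l } | .rows => { s with rows := l }
  | .cols => { s with cols := l } | .cols' => { s with cols' := l } | .arg => { s with arg := l }
  | .res => { s with res := l } | .thr => { s with thr := l } | .thr' => { s with thr' := l }
  | .tmp => { s with tmp := l } | .fro => { s with fro := l }
  | .fro' => { s with fro' := l } | .one => { s with one := l } | .one' => { s with one' := l }
  | .two => { s with two := l } | .two' => { s with two' := l } | .del1 => { s with del1 := l }
  | .del2 => { s with del2 := l } | .buf => { s with buf := l } | .buf' => { s with buf' := l }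
  | .hit1 => { s with hit1 := l } | .hit2 => { s with hit2 := l } | .out => { s with out := l }

theorem ext_get {s t : Store} (h : ∀ k, s.get k = t.get k) : s = t := by
  cases s; cases t
  simp only [mk.injEq]
  exact ⟨h .inp, h .aux, h .mark, h .len, h .len', h .rows, h .cols, h .cols', h .arg, h .res,
    h .thr, h .thr', h .tmp, h .fro, h .fro', h .one, h .one', h .two, h .two', h .del1,
    h .del2, h .buf, h .buf', h .hit1, h .hit2, h .out⟩

@[simp] theorem get_set_self (s : Store) (k : Stk) (l : List Bool) : (s.set k l).get k = l := by
  cases k <;> rfl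

@[simp] theorem get_set_of_ne (s : Store) {k j : Stk} (l : List Bool) (h : j ≠ k) :
    (s.set k l).get j = s.get j := by
  cases k <;> cases j <;> first | rfl | exact absurd rfl h

theorem get_set (s : Store) (k : Stk) (l : List Bool) :
    (s.set k l).get = Function.update s.get k l := by
  funext j
  by_cases h : j = k
  · subst h; simp
  · simp [h]

@[simp] theorem set_set (s : Store) (k : Stk) (l l' : List Bool) :
    (s.set k l).set k l' = s.set k l' := by
  cases k <;> rfl

@[simp] theorem set_get (s : Store) (k : Stk) : s.set k (s.get k) = s := by
  cases k <;> rfl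

theorem set_comm (s : Store) {k j : Stk} (h : j ≠ k) (l l' : List Bool) :
    (s.set k l).set j l' = (s.set j l').set k l :=
  ext_get fun i => by
    simp only [get_set]
    rw [Function.update_comm h]

end Store

/-- Programs over the stacks. `case` and `loop` pop a stack and branch on the result; `loop` stops
when the stack is empty; `call` stands for a given Turing machine, applied to the reversed contents
of the stack `arg`. -/
inductive Prog
  | skip
  | push (k : Stk) (b : Bool)
  | seq (p q : Prog)
  | case (k : Stk) (e : Prog) (p : Bool → Prog)
  | loop (k : Stk) (p : Bool → Prog)
  | call

/-- Sequential composition of programs. -/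
infixr:60 " ;; " => Prog.seq

/-- `Exec R p s s' t`: the program `p`, started with store `s`, ends with store `s'` within `t`
steps, where `R x y t` says that the called machine answers `y` to the input `x` within `t`
steps. -/
inductive Exec (R : List Bool → List Bool → ℕ → Prop) : Prog → Store → Store → ℕ → Prop
  | skip (s) : Exec R .skip s s 1
  | push (k b s) : Exec R (.push k b) s (s.set k (b :: s.get k)) 1
  | seq {p q s s' s'' t t'} : Exec R p s s' t → Exec R q s' s'' t' →
      Exec R (.seq p q) s s'' (t + t')
  | case_nil {k e p s s' t} : s.get k = [] → Exec R e s s' t → Exec R (.case k e p) s s' (t + 1)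
  | case_cons {k e p s s' t b l} : s.get k = b :: l → Exec R (p b) (s.set k l) s' t →
      Exec R (.case k e p) s s' (t + 1)
  | loop_nil {k p s} : s.get k = [] → Exec R (.loop k p) s s 1
  | loop_cons {k p s s' s'' t t' b l} : s.get k = b :: l → Exec R (p b) (s.set k l) s' t →
      Exec R (.loop k p) s' s'' t' → Exec R (.loop k p) s s'' (t + 1 + t')
  | call {s x y t} : R x y t → s.get .arg = x.reverse → s.get .res = [] →
      Exec R .call s ((s.set .arg []).set .res y.reverse) (t + x.length + y.length + 2)
  | weaken {p s s' t t'} : Exec R p s s' t → t ≤ t' → Exec R p s s' t'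

/-! ### Compilation of stack programs to multi-stack machines -/

namespace Prog

open Turing Turing.TM2 StateTransition

variable (c : TM2ComputableAux Bool Bool)

/-- The control points of a program. -/
def Lab : Prog → Type
  | skip => Unit
  | push _ _ => Unit
  | seq p q => p.Lab ⊕ q.Lab
  | case _ e p => Option (e.Lab ⊕ (b : Bool) × (p b).Lab)
  | loop _ p => Option ((b : Bool) × (p b).Lab)
  | call => c.tm.Λ ⊕ Bool

/-- The control point at which a program starts. -/
def entry : (p : Prog) → p.Lab c
  | skip => ()
  | push _ _ => ()
  | seq p _ => .inl p.entry
  | case _ _ _ => none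
  | loop _ _ => none
  | call => .inr true

/-- There are finitely many control points. -/
@[reducible] noncomputable def labFintype : (p : Prog) → Fintype (p.Lab c)
  | skip => inferInstanceAs (Fintype Unit)
  | push _ _ => inferInstanceAs (Fintype Unit)
  | seq p q =>
    letI := p.labFintype
    letI := q.labFintype
    inferInstanceAs (Fintype (p.Lab c ⊕ q.Lab c))
  | case _ e p =>
    letI := e.labFintype
    letI := fun b => (p b).labFintype
    inferInstanceAs (Fintype (Option (e.Lab c ⊕ (b : Bool) × (p b).Lab c)))
  | loop _ p =>
    letI := fun b => (p b).labFintype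
    inferInstanceAs (Fintype (Option ((b : Bool) × (p b).Lab c)))
  | call =>
    letI := c.tm.ΛFin
    inferInstanceAs (Fintype (c.tm.Λ ⊕ Bool))

/-- The stack alphabets of a compiled program. -/
@[reducible] def Alph : Stk ⊕ c.tm.K → Type
  | .inl _ => Bool
  | .inr k => c.tm.Γ k

/-- The internal states of a compiled program: the symbol popped last, and the state of the called
machine. -/
abbrev Var : Type := Option Bool × c.tm.σ

variable {Λ : Type}

/-- The statements of the called machine, as statements of a compiled program. -/
def liftStmt (emb : c.tm.Λ → Λ) (ret : Λ) :
    Stmt c.tm.Γ c.tm.Λ c.tm.σ → Stmt (Alph c) Λ (Var c)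
  | .push k f q => .push (.inr k) (fun v => f v.2) (liftStmt emb ret q)
  | .peek k f q => .peek (.inr k) (fun v o => (v.1, f v.2 o)) (liftStmt emb ret q)
  | .pop k f q => .pop (.inr k) (fun v o => (v.1, f v.2 o)) (liftStmt emb ret q)
  | .load f q => .load (fun v => (v.1, f v.2)) (liftStmt emb ret q)
  | .branch f q q' => .branch (fun v => f v.2) (liftStmt emb ret q) (liftStmt emb ret q')
  | .goto f => .goto fun v => emb (f v.2)
  | .halt => .goto fun _ => ret

/-- The code of a program, where `emb` places its control points among the labels of a machine and
`ex` is the label at which to go on. -/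
def code : (p : Prog) → (emb : p.Lab c → Λ) → (ex : Λ) → p.Lab c → Stmt (Alph c) Λ (Var c)
  | skip, _, ex, _ => .goto fun _ => ex
  | push k b, _, ex, _ => .push (.inl k) (fun _ => b) (.goto fun _ => ex)
  | seq p q, emb, _, .inl l => p.code (fun l => emb (.inl l)) (emb (.inr (q.entry c))) l
  | seq _ q, emb, ex, .inr l => q.code (fun l => emb (.inr l)) ex l
  | case k e p, emb, _, none =>
    .pop (.inl k) (fun v o => (o, v.2)) (.goto fun v =>
      match v.1 with
      | none => emb (some (.inl (e.entry c)))
      | some b => emb (some (.inr ⟨b, (p b).entry c⟩)))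
  | case _ e _, emb, ex, some (.inl l) => e.code (fun l => emb (some (.inl l))) ex l
  | case _ _ p, emb, ex, some (.inr ⟨b, l⟩) =>
    (p b).code (fun l => emb (some (.inr ⟨b, l⟩))) ex l
  | loop k p, emb, ex, none =>
    .pop (.inl k) (fun v o => (o, v.2)) (.goto fun v =>
      match v.1 with
      | none => ex
      | some b => emb (some ⟨b, (p b).entry c⟩))
  | loop _ p, emb, _, some ⟨b, l⟩ => (p b).code (fun l => emb (some ⟨b, l⟩)) (emb none) l
  | call, emb, _, .inl l =>
    liftStmt c (fun l => emb (.inl l)) (emb (.inr false)) (c.tm.m l)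
  | call, emb, _, .inr true =>
    .pop (.inl .arg) (fun v o => (o, v.2)) (.branch (fun v => v.1.isSome)
      (.push (.inr c.tm.k₀) (fun v => c.inputAlphabet.symm (v.1.getD false))
        (.goto fun _ => emb (.inr true)))
      (.goto fun _ => emb (.inl c.tm.main)))
  | call, emb, ex, .inr false =>
    .pop (.inr c.tm.k₁) (fun v o => (o.map c.outputAlphabet, v.2)) (.branch (fun v => v.1.isSome)
      (.push (.inl .res) (fun v => v.1.getD false) (.goto fun _ => emb (.inr false)))
      (.goto fun _ => ex))

/-- The joint contents of the stacks of a program and of the called machine. -/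
def joint (s : Store) (S : ∀ k, List (c.tm.Γ k)) : ∀ k, List (Alph c k)
  | .inl k => s.get k
  | .inr k => S k

theorem update_joint_inl (s : Store) (S : ∀ k, List (c.tm.Γ k)) (k : Stk) (l : List Bool) :
    Function.update (joint c s S) (.inl k) l = joint c (s.set k l) S := by
  funext j
  rcases j with j | j
  · by_cases h : j = k
    · subst h
      exact (Function.update_self _ _ _).trans (Store.get_set_self _ _ _).symm
    · exact (Function.update_of_ne (by simpa using h) _ _).trans (Store.get_set_of_ne _ _ h).symm
  · exact Function.update_of_ne (by simp) _ _

theorem update_joint_inr (s : Store) (S : ∀ k, List (c.tm.Γ k)) (k : c.tm.K)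
    (l : List (c.tm.Γ k)) :
    Function.update (joint c s S) (.inr k) l = joint c s (Function.update S k l) := by
  funext j
  rcases j with j | j
  · exact Function.update_of_ne (by simp) _ _
  · by_cases h : j = k
    · subst h
      exact (Function.update_self _ _ _).trans (Function.update_self j l S).symm
    · have e : Function.update S k l j = S j := Function.update_of_ne h _ _
      exact (Function.update_of_ne (by simpa using h) _ _).trans e.symm

/-- A configuration of the called machine, as a configuration of a compiled program. -/
def liftCfg (emb : c.tm.Λ → Λ) (ret : Λ) (s : Store) (o : Option Bool)
    (C : Cfg c.tm.Γ c.tm.Λ c.tm.σ) : Cfg (Alph c) Λ (Var c) :=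
  ⟨some (C.l.elim ret emb), (o, C.var), joint c s C.stk⟩

/-- A lifted statement touches neither the stacks of the program nor its last popped symbol. Halting
becomes a jump to `ret`, which is why `liftCfg` sends a halted configuration to the label `ret`. -/
theorem stepAux_liftStmt (emb : c.tm.Λ → Λ) (ret : Λ) (s : Store) (o : Option Bool)
    (q : Stmt c.tm.Γ c.tm.Λ c.tm.σ) (v : c.tm.σ) (S : ∀ k, List (c.tm.Γ k)) :
    stepAux (liftStmt c emb ret q) (o, v) (joint c s S) =
      liftCfg c emb ret s o (stepAux q v S) := by
  induction q generalizing v S with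
  | push k f q ih =>
    exact (congrArg (stepAux (liftStmt c emb ret q) (o, v))
      (update_joint_inr c s S k (f v :: S k))).trans (ih v _)
  | peek k f q ih => exact ih _ S
  | pop k f q ih =>
    exact (congrArg (stepAux (liftStmt c emb ret q) (o, f v (S k).head?))
      (update_joint_inr c s S k (S k).tail)).trans (ih _ _)
  | load f q ih => exact ih _ S
  | branch f q q' ih ih' =>
    simp only [liftStmt, stepAux]
    cases f v
    · exact ih' v S
    · exact ih v S
  | goto f => rfl
  | halt => rfl

end Prog

/-! ### Timed reachability and correctness of the compiled code -/

open Turing Turing.TM2 StateTransition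

/-- The machine reaches the configuration `b` from `a` within `t` steps. -/
def ReachesIn {σ : Type} (f : σ → Option σ) (a b : σ) (t : ℕ) : Prop :=
  Nonempty (EvalsToInTime f a (some b) t)

namespace ReachesIn

variable {σ : Type} {f : σ → Option σ} {a b d : σ} {t t' : ℕ}

theorem trans (h : ReachesIn f a b t) (h' : ReachesIn f b d t') : ReachesIn f a d (t + t') := by
  obtain ⟨h⟩ := h
  obtain ⟨h'⟩ := h'
  rw [add_comm]
  exact ⟨h.trans _ _ _ _ _ _ h'⟩

theorem single (h : f a = some b) : ReachesIn f a b 1 :=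
  ⟨⟨⟨1, h⟩, le_rfl⟩⟩

theorem mono (h : ReachesIn f a b t) (ht : t ≤ t') : ReachesIn f a b t' := by
  obtain ⟨h⟩ := h
  exact ⟨⟨h.toEvalsTo, h.steps_le_m.trans ht⟩⟩

theorem iterate_none (f : σ → Option σ) (n : ℕ) : (flip Bind.bind f)^[n] none = none := by
  induction n with
  | zero => rfl
  | succ n ih => rw [Function.iterate_succ_apply]; exact ih

/-- Simulation of one machine by another, step by step. -/
theorem map {τ : Type} {g : τ → Option τ} (F : σ → τ)
    (hF : ∀ a b, f a = some b → g (F a) = some (F b)) (h : ReachesIn f a b t) :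
    ReachesIn g (F a) (F b) t := by
  obtain ⟨⟨⟨n, hn⟩, ht⟩⟩ := h
  refine ⟨⟨⟨n, ?_⟩, ht⟩⟩
  clear ht
  induction n generalizing a with
  | zero =>
    have : a = b := by simpa using hn
    subst this; rfl
  | succ n ih =>
    rw [Function.iterate_succ_apply] at hn ⊢
    change (flip Bind.bind f)^[n] (f a) = some b at hn
    change (flip Bind.bind g)^[n] (g (F a)) = some (F b)
    cases hfa : f a with
    | none => rw [hfa, iterate_none] at hn; cases hn
    | some a' =>
      rw [hfa] at hn
      rw [hF a a' hfa]
      exact ih hn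

end ReachesIn

/-- The input-output relation of a machine, with the time it takes. -/
def CallRel (c : TM2ComputableAux Bool Bool) (x y : List Bool) (t : ℕ) : Prop :=
  Nonempty (TM2OutputsInTime c.tm (x.map c.inputAlphabet.invFun)
    (some (y.map c.outputAlphabet.invFun)) t)

namespace Prog

variable (c : TM2ComputableAux Bool Bool) {Λ : Type} (M : Λ → Stmt (Alph c) Λ (Var c))

/-- The configuration of a compiled program between two of its parts. -/
def cfg (l : Λ) (o : Option Bool) (s : Store) : Cfg (Alph c) Λ (Var c) :=
  ⟨some l, (o, c.tm.initialState), joint c s fun _ => []⟩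

variable {M} in
theorem step_of_eq {l : Λ} {q : Stmt (Alph c) Λ (Var c)} (h : M l = q) (v : Var c)
    (S : ∀ k, List (Alph c k)) : step M ⟨some l, v, S⟩ = some (stepAux q v S) := by
  rw [step, h]

variable {M} in
theorem step_pop {l : Λ} {k : Stk} {g : Var c → Λ}
    (h : M l = .pop (.inl k) (fun v o => (o, v.2)) (.goto g)) (o : Option Bool) (s : Store) :
    step M (cfg c l o s) = some (cfg c (g ((s.get k).head?, c.tm.initialState)) (s.get k).head?
      (s.set k (s.get k).tail)) := by
  rw [cfg, step_of_eq c h]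
  exact congrArg (fun S => some (Cfg.mk _ _ S)) (update_joint_inl c s _ k (s.get k).tail)

theorem joint_initList (s : Store) (x : List (c.tm.Γ c.tm.k₀)) :
    joint c s (Function.update (fun _ => []) c.tm.k₀ x) = joint c s (initList c.tm x).stk := by
  congr 1
  funext k
  by_cases h : k = c.tm.k₀
  · subst h; simp [initList]
  · simp [initList, h]

theorem joint_haltList (s : Store) (x : List (c.tm.Γ c.tm.k₁)) :
    joint c s (haltList c.tm x).stk = joint c s (Function.update (fun _ => []) c.tm.k₁ x) := by
  congr 1
  funext k
  by_cases h : k = c.tm.k₁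
  · subst h; simp [haltList]
  · simp [haltList, h]

/-- Popping `arg` and pushing onto the input stack of the called machine reverses the word, which is
why `Exec.call` expects `x.reverse` on `arg`. The part `z` already copied is arbitrary for the sake
of the induction. -/
theorem reachesIn_copyIn (emb : call.Lab c → Λ) (ex : Λ)
    (hM : ∀ l, M (emb l) = code c call emb ex l)
    (x : List Bool) (z : List (c.tm.Γ c.tm.k₀)) (o : Option Bool) (s : Store)
    (hs : s.get .arg = x) :
    ∃ o', ReachesIn (step M)
      ⟨some (emb (.inr true)), (o, c.tm.initialState),
        joint c s (Function.update (fun _ => []) c.tm.k₀ z)⟩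
      ⟨some (emb (.inl c.tm.main)), (o', c.tm.initialState),
        joint c (s.set .arg []) (Function.update (fun _ => []) c.tm.k₀
          (x.reverse.map c.inputAlphabet.symm ++ z))⟩ (x.length + 1) := by
  induction x generalizing z o s with
  | nil =>
    refine ⟨none, ReachesIn.single ((step_of_eq c (q := .pop (.inl .arg) _ (.branch _ _ _))
      (hM (.inr true)) _ _).trans ?_)⟩
    rw [stepAux]
    change some (stepAux (.branch _ _ _) ((s.get .arg).head?, c.tm.initialState)
      (Function.update (joint c s _) (.inl .arg) (s.get .arg).tail)) = _
    rw [update_joint_inl, hs]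
    rfl
  | cons b x ih =>
    obtain ⟨o', h⟩ := ih (c.inputAlphabet.symm b :: z) (some b) (s.set .arg x) rfl
    refine ⟨o', ?_⟩
    have h1 : step M ⟨some (emb (.inr true)), (o, c.tm.initialState),
        joint c s (Function.update (fun _ => []) c.tm.k₀ z)⟩ =
        some ⟨some (emb (.inr true)), (some b, c.tm.initialState), joint c (s.set .arg x)
          (Function.update (fun _ => []) c.tm.k₀ (c.inputAlphabet.symm b :: z))⟩ := by
      refine (step_of_eq c (q := .pop (.inl .arg) _ (.branch _ _ _)) (hM (.inr true)) _ _).trans ?_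
      rw [stepAux]
      change some (stepAux (.branch _ _ _) ((s.get .arg).head?, c.tm.initialState)
        (Function.update (joint c s _) (.inl .arg) (s.get .arg).tail)) = _
      rw [update_joint_inl, hs]
      change some (Cfg.mk _ _ (Function.update (joint c _ _) (.inr c.tm.k₀)
        (c.inputAlphabet.symm b :: Function.update (fun _ => []) c.tm.k₀ z c.tm.k₀))) = _
      rw [update_joint_inr, Function.update_self, Function.update_idem]
      rfl
    have := (ReachesIn.single h1).trans h
    refine ReachesIn.mono (by simpa using this) ?_
    simp; omega

/-- The answer is reversed while being copied, so that the last symbol of `y` ends on top of `res`.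
For a binary number this is the leading bit, the one that Horner's scheme reads first. -/
theorem reachesIn_copyOut (emb : call.Lab c → Λ) (ex : Λ)
    (hM : ∀ l, M (emb l) = code c call emb ex l)
    (y : List (c.tm.Γ c.tm.k₁)) (o : Option Bool) (s : Store) :
    ∃ o', ReachesIn (step M)
      ⟨some (emb (.inr false)), (o, c.tm.initialState),
        joint c s (Function.update (fun _ => []) c.tm.k₁ y)⟩
      (cfg c ex o' (s.set .res ((y.map c.outputAlphabet).reverse ++ s.get .res)))
      (y.length + 1) := by
  induction y generalizing o s with
  | nil =>
    refine ⟨none, ReachesIn.single ((step_of_eq c (q := .pop (.inr c.tm.k₁) _ (.branch _ _ _))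
      (hM (.inr false)) _ _).trans ?_)⟩
    rw [stepAux, Function.update_eq_self]
    change some (stepAux (.branch _ _ _) (none, c.tm.initialState)
      (Function.update (joint c s _) (.inr c.tm.k₁) [])) = _
    rw [update_joint_inr, Function.update_eq_self]
    rfl
  | cons b y ih =>
    obtain ⟨o', h⟩ := ih (some (c.outputAlphabet b))
      (s.set .res (c.outputAlphabet b :: s.get .res))
    refine ⟨o', ?_⟩
    have h1 : step M ⟨some (emb (.inr false)), (o, c.tm.initialState),
        joint c s (Function.update (fun _ => []) c.tm.k₁ (b :: y))⟩ =
        some ⟨some (emb (.inr false)), (some (c.outputAlphabet b), c.tm.initialState),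
          joint c (s.set .res (c.outputAlphabet b :: s.get .res))
          (Function.update (fun _ => []) c.tm.k₁ y)⟩ := by
      obtain ⟨S, hS⟩ :
          ∃ S, S = Function.update (fun k => ([] : List (c.tm.Γ k))) c.tm.k₁ (b :: y) := ⟨_, rfl⟩
      have hS' : S c.tm.k₁ = b :: y := by rw [hS, Function.update_self]
      rw [← hS]
      refine (step_of_eq c (q := .pop (.inr c.tm.k₁) _ (.branch _ _ _)) (hM (.inr false)) _ _).trans
        ?_
      rw [stepAux]
      change some (stepAux (.branch _ _ _)
        ((S c.tm.k₁).head?.map c.outputAlphabet, c.tm.initialState)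
        (Function.update (joint c s S) (.inr c.tm.k₁) (S c.tm.k₁).tail)) = _
      rw [update_joint_inr, hS', hS, Function.update_idem]
      change some (Cfg.mk _ _ (Function.update (joint c _ _) (.inl .res)
        (c.outputAlphabet b :: s.get .res))) = _
      rw [update_joint_inl]
      rfl
    have := (ReachesIn.single h1).trans h
    refine ReachesIn.mono (by simpa using this) ?_
    simp; omega

/-- The compiled code runs as the program does. -/
theorem reachesIn_of_exec {p : Prog} {s s' : Store} {t : ℕ} (h : Exec (CallRel c) p s s' t)
    (emb : p.Lab c → Λ) (ex : Λ) (hM : ∀ l, M (emb l) = p.code c emb ex l) (o : Option Bool) :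
    ∃ o', ReachesIn (step M) (cfg c (emb (p.entry c)) o s) (cfg c ex o' s') t := by
  -- The exit label varies, since the first part of a sequence exits into the second and a loop body
  -- into the loop head. The symbol popped last is stale between two parts and is only tracked
  -- existentially.
  induction h generalizing ex o with
  | skip s =>
    exact ⟨o, ReachesIn.single (step_of_eq c (hM ()) _ _)⟩
  | push k b s =>
    refine ⟨o, ReachesIn.single ?_⟩
    refine (step_of_eq c (hM ()) _ _).trans ?_
    exact congrArg (fun S => some (Cfg.mk _ _ S)) (update_joint_inl c s _ k (b :: s.get k))
  | @seq p q s s' s'' t t' h h' ih ih' =>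
    obtain ⟨o₁, h₁⟩ := ih (fun l => emb (.inl l)) (emb (.inr (q.entry c)))
      (fun l => hM _) o
    obtain ⟨o₂, h₂⟩ := ih' (fun l => emb (.inr l)) ex (fun l => hM _) o₁
    exact ⟨o₂, h₁.trans h₂⟩
  | @case_nil k e p s s' t hk h ih =>
    obtain ⟨o₁, h₁⟩ := ih (fun l => emb (some (.inl l))) ex (fun l => hM _) none
    refine ⟨o₁, ?_⟩
    rw [add_comm]
    refine (ReachesIn.single ?_).trans h₁
    refine (step_pop c (hM none) o s).trans ?_
    rw [hk, List.tail_nil, show s.set k [] = s by rw [← hk, Store.set_get]]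
    rfl
  | @case_cons k e p s s' t b l hk h ih =>
    obtain ⟨o₁, h₁⟩ := ih (fun l => emb (some (.inr ⟨b, l⟩))) ex (fun l => hM _)
      (some b)
    refine ⟨o₁, ?_⟩
    rw [add_comm]
    refine (ReachesIn.single ?_).trans h₁
    refine (step_pop c (hM none) o s).trans ?_
    rw [hk]
    rfl
  | @loop_nil k p s hk =>
    refine ⟨none, ReachesIn.single ?_⟩
    refine (step_pop c (hM none) o s).trans ?_
    rw [hk, List.tail_nil, show s.set k [] = s by rw [← hk, Store.set_get]]
    rfl
  | @loop_cons k p s s' s'' t t' b l hk h h' ih ih' =>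
    obtain ⟨o₁, h₁⟩ := ih (fun l => emb (some ⟨b, l⟩)) (emb none) (fun l => hM _)
      (some b)
    obtain ⟨o₂, h₂⟩ := ih' emb ex hM o₁
    refine ⟨o₂, ?_⟩
    rw [add_comm t]
    refine ((ReachesIn.single ?_).trans h₁).trans h₂
    refine (step_pop c (hM none) o s).trans ?_
    rw [hk]
    rfl
  | @call s x y t h hx hy =>
    obtain ⟨o₁, h₁⟩ := reachesIn_copyIn c M emb ex hM x.reverse [] o s hx
    rw [Function.update_eq_self, List.append_nil, List.reverse_reverse, joint_initList] at h₁
    -- A halted configuration has no successor, so only configurations with a label have to be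
    -- simulated.
    have h₂ : ReachesIn (step M) _ _ t := ReachesIn.map (f := step c.tm.m)
      (liftCfg c (fun l => emb (.inl l)) (emb (.inr false)) (s.set .arg []) o₁) (by
        rintro ⟨l, v, S⟩ b hb
        cases l with
        | none => cases hb
        | some l =>
          simp only [step, Option.some.injEq] at hb
          subst hb
          refine (step_of_eq c (hM (.inl l)) _ _).trans ?_
          exact congrArg some (stepAux_liftStmt c _ _ _ _ _ _ _)) h
    obtain ⟨o₃, h₃⟩ := reachesIn_copyOut c M emb ex hM (y.map c.outputAlphabet.invFun) o₁
      (s.set .arg [])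
    rw [← joint_haltList] at h₃
    simp only [List.map_map, Function.comp_def, Equiv.invFun_as_coe, Equiv.apply_symm_apply,
      List.map_id', List.length_map, Store.get_set_of_ne _ _ (show Stk.res ≠ Stk.arg by decide),
      hy, List.append_nil] at h₃
    refine ⟨o₃, ReachesIn.mono ((h₁.trans h₂).trans h₃) ?_⟩
    simp; omega
  | weaken _ ht ih =>
    obtain ⟨o', h'⟩ := ih emb ex hM o
    exact ⟨o', h'.mono ht⟩

/-- The machine that runs a program on the input stack `inp` and the output stack `out`. -/
noncomputable def machine (p : Prog) : FinTM2 :=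
  letI := p.labFintype c
  letI := c.tm.kFin
  letI := c.tm.σFin
  letI : Fintype (Alph c (.inl .inp)) := inferInstanceAs (Fintype Bool)
  { K := Stk ⊕ c.tm.K
    k₀ := .inl .inp
    k₁ := .inl .out
    Γ := Alph c
    Λ := Option (p.Lab c)
    main := some (p.entry c)
    σ := Var c
    initialState := (none, c.tm.initialState)
    m := fun l => l.elim (.load (fun _ => (none, c.tm.initialState)) .halt)
      (p.code c some none) }

/-- A program which computes a function in polynomial time yields a Turing machine which does. -/
theorem computableInPolyTime {α β : Type} (p : Prog) (ea : α → List Bool) (eb : β → List Bool)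
    (f : α → β) (T : Polynomial ℕ)
    (h : ∀ a, Exec (CallRel c) p { inp := ea a } { out := eb (f a) } (T.eval (ea a).length)) :
    Nonempty (TM2ComputableInPolyTime ea eb f) := by
  refine ⟨⟨⟨machine c p, Equiv.refl Bool, Equiv.refl Bool⟩, T + 1, fun a => Nonempty.some ?_⟩⟩
  obtain ⟨o, h₁⟩ := reachesIn_of_exec c (machine c p).m (h a) some none (fun _ => rfl) none
  -- The exit label `none` costs one more step, whence `T + 1`. It resets the symbol popped last,
  -- because `haltList` requires the initial internal state.
  have h₂ : step (machine c p).m (cfg c none o { out := eb (f a) }) = some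
      ⟨none, (none, c.tm.initialState), joint c { out := eb (f a) } fun _ => []⟩ := rfl
  have h₃ := h₁.trans (ReachesIn.single h₂)
  have e₁ : initList (machine c p) (ea a) =
      cfg c (some (p.entry c)) none { inp := ea a } := by
    simp only [initList, cfg]
    congr 1
    funext k
    rcases k with k | k
    · cases k <;> rfl
    · rfl
  have e₂ : haltList (machine c p) (eb (f a)) =
      ⟨none, (none, c.tm.initialState), joint c { out := eb (f a) } fun _ => []⟩ := by
    simp only [haltList]
    congr 1
    funext k
    rcases k with k | k
    · cases k <;> rfl
    · rfl
  have e₃ : ∀ l : List Bool, List.map (Equiv.refl Bool).invFun l = l := fun l => List.map_id l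
  change Nonempty (EvalsToInTime _ (initList (machine c p) (List.map (Equiv.refl Bool).invFun _))
    (some (haltList (machine c p) (List.map (Equiv.refl Bool).invFun _))) _)
  simp only [Polynomial.eval_add, Polynomial.eval_one]
  erw [e₃, e₃, e₁, e₂]
  exact h₃

end Prog

/-! ### Length of the answer of a machine -/

section

open Turing Turing.TM2 StateTransition

/-- The number of symbols that a statement pushes at most. -/
def Turing.TM2.Stmt.pushes {K : Type} {Γ : K → Type} {Λ σ : Type} : Stmt Γ Λ σ → ℕ
  | .push _ _ q => q.pushes + 1
  | .peek _ _ q => q.pushes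
  | .pop _ _ q => q.pushes
  | .load _ q => q.pushes
  | .branch _ q q' => q.pushes + q'.pushes
  | .goto _ => 0
  | .halt => 0

theorem Turing.TM2.length_stepAux_le {K : Type} [DecidableEq K] {Γ : K → Type} {Λ σ : Type}
    (q : Stmt Γ Λ σ) (v : σ) (S : ∀ k, List (Γ k)) (k : K) :
    ((stepAux q v S).stk k).length ≤ (S k).length + q.pushes := by
  induction q generalizing v S with
  | push j f q ih =>
    refine (ih _ _).trans ?_
    by_cases h : k = j
    · subst h; simp [Stmt.pushes]; omega
    · simp [Stmt.pushes, h]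
  | peek j f q ih => exact ih _ _
  | pop j f q ih =>
    refine (ih _ _).trans ?_
    by_cases h : k = j
    · subst h; simp [Stmt.pushes]
    · simp [Stmt.pushes, h]
  | load f q ih => exact ih _ _
  | branch f q q' ih ih' =>
    simp only [stepAux, Stmt.pushes]
    cases f v
    · exact (ih' v S).trans (by omega)
    · exact (ih v S).trans (by omega)
  | goto f => simp [Stmt.pushes]
  | halt => simp [Stmt.pushes]

/-- The length of the answer of a machine is linear in the length of the input and the time. -/
theorem CallRel.exists_length_le (c : TM2ComputableAux Bool Bool) :
    ∃ D : ℕ, ∀ x y t, CallRel c x y t → y.length ≤ x.length + D * t := by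
  let := c.tm.ΛFin
  obtain ⟨D, hD⟩ : ∃ D, ∀ l, (c.tm.m l).pushes ≤ D :=
    ⟨Finset.univ.sup fun l => (c.tm.m l).pushes, fun l =>
      Finset.le_sup (f := fun l => (c.tm.m l).pushes) (Finset.mem_univ l)⟩
  -- There are finitely many labels, so a single `D` bounds the symbols pushed in any one step.
  have key : ∀ (n : ℕ) (a b : c.tm.Cfg) (k : c.tm.K),
      (flip Bind.bind c.tm.step)^[n] (some a) = some b →
      (b.stk k).length ≤ (a.stk k).length + D * n := by
    intro n
    induction n with
    | zero =>
      intro a b k h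
      have : a = b := by simpa using h
      subst this; simp
    | succ n ih =>
      intro a b k h
      rw [Function.iterate_succ_apply] at h
      change (flip Bind.bind c.tm.step)^[n] (c.tm.step a) = some b at h
      obtain ⟨_ | l, v, S⟩ := a
      · change (flip Bind.bind c.tm.step)^[n] none = some b at h
        rw [ReachesIn.iterate_none] at h
        cases h
      · have h1 := ih (stepAux (c.tm.m l) v S) b k h
        have h2 := length_stepAux_le (c.tm.m l) v S k
        have h3 := hD l
        change _ ≤ (S k).length + _
        rw [mul_add]
        omega
  refine ⟨D, fun x y t ⟨⟨⟨n, hn⟩, ht⟩⟩ => ?_⟩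
  have h := key n _ _ c.tm.k₁ hn
  have h1 : ((haltList c.tm (y.map c.outputAlphabet.invFun)).stk c.tm.k₁).length = y.length := by
    simp [haltList]
  -- The output stack may be the input stack, in which case it starts with the input on it; this is
  -- the summand `x.length`.
  have h2 : ((initList c.tm (x.map c.inputAlphabet.invFun)).stk c.tm.k₁).length ≤ x.length := by
    by_cases h : c.tm.k₁ = c.tm.k₀
    · rw [h]; simp [initList]
    · simp [initList, h]
  have h3 : D * n ≤ D * t := Nat.mul_le_mul_left D ht
  rw [h1] at h
  omega

end

/-! ### Binary and unary encodings of numbers -/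

theorem foldr_encodePosNum (n : PosNum) :
    (Computability.encodePosNum n).foldr (fun b a => 2 * a + b.toNat) 0 = (n : ℕ) := by
  induction n with
  | one => rfl
  | bit0 n ih => simp [Computability.encodePosNum, ih]; omega
  | bit1 n ih => simp [Computability.encodePosNum, ih]; omega

theorem foldr_encodeNat (n : ℕ) :
    (Computability.encodeNat n).foldr (fun b a => 2 * a + b.toNat) 0 = n := by
  unfold Computability.encodeNat
  conv_rhs => rw [← Num.to_of_nat n]
  cases (n : Num) with
  | zero => rfl
  | pos m => exact foldr_encodePosNum m

/-- Decoding of a binary number, truncated at `N`. -/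
theorem foldl_reverse_encodeNat_min (n N : ℕ) :
    (Computability.encodeNat n).reverse.foldl (fun a b => min (2 * a + b.toNat) N) 0 =
      min n N := by
  rw [List.foldl_reverse]
  conv_rhs => rw [← foldr_encodeNat n]
  induction Computability.encodeNat n with
  | nil => simp
  | cons b l ih =>
    rw [List.foldr_cons, List.foldr_cons, ih]
    omega

theorem unaryEncodeNat_eq_replicate (n : ℕ) :
    Computability.unaryEncodeNat n = List.replicate n true := by
  induction n with
  | zero => rfl
  | succ n ih => rw [Computability.unaryEncodeNat, ih, List.replicate_succ]

theorem Polynomial.eval_mono_nat (p : Polynomial ℕ) {a b : ℕ} (h : a ≤ b) :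
    p.eval a ≤ p.eval b := by
  rw [Polynomial.eval_eq_sum, Polynomial.eval_eq_sum]
  exact Finset.sum_le_sum fun i _ => Nat.mul_le_mul_left _ (Nat.pow_le_pow_left h i)

/-! Sets of vertices are represented by lists of Booleans. -/

/-! ### The branching process: correctness and size of the family -/

namespace Mask

/-- Remove the elements of the second set from the first. -/
def del : List Bool → List Bool → List Bool
  | [], _ => []
  | v :: vs, [] => v :: vs
  | v :: vs, b :: bs => (v && !b) :: del vs bs

/-- Whether two sets meet. -/
def hit : List Bool → List Bool → Bool
  | [], _ => false
  | _ :: _, [] => false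
  | v :: vs, b :: bs => (v && b) || hit vs bs

/-- Add the elements of the second set to the first, without growing the list. -/
def ins : List Bool → List Bool → List Bool
  | [], _ => []
  | v :: vs, [] => v :: vs
  | v :: vs, b :: bs => (v || b) :: ins vs bs

/-- The set `{i}`. -/
def single (i : ℕ) : List Bool := List.replicate i false ++ [true]

/-- Membership of a number in a set. -/
def Has (v : List Bool) (k : ℕ) : Prop := v.getD k false = true

instance (v : List Bool) : DecidablePred (Has v) := fun _ =>
  inferInstanceAs (Decidable (_ = true))

/-- The sets that replace `v` if the elements of `I` and `J` are in conflict, without those of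
fewer than `g` elements. -/
def branch (g : ℕ) (I J v : List Bool) : List (List Bool) :=
  (if hit v I && hit v J then [del v I, del v J] else [v]).filter fun u => g ≤ u.count true

/-- Split the sets by the conflicts given by a part of a row of an adjacency matrix. -/
def processRow (g i : ℕ) : ℕ → List Bool → List (List Bool) → List (List Bool)
  | _, [], L => L
  | j, b :: bs, L =>
    processRow g i (j + 1) bs (if b then L else L.flatMap (branch g (single i) (single j)))

/-- Split the sets by the conflicts given by some rows of an adjacency matrix. -/
def processRows (g : ℕ) : ℕ → List (List Bool) → List (List Bool) → List (List Bool)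
  | _, [], L => L
  | i, r :: rs, L => processRows g (i + 1) rs (processRow g i 0 r L)

/-- All sets obtained by adding a number below `n`. -/
def expand (n : ℕ) (v : List Bool) : List (List Bool) :=
  (List.range n).map fun i => ins v (single i)

/-- The sets to start with: for small `g` all sets of at most `g` elements, otherwise the whole
set. -/
def initial (c n g : ℕ) : List (List Bool) :=
  if g ≤ c then (fun L => L.flatMap (expand n))^[g] [List.replicate n false]
  else [List.replicate n true]

/-- The sets which are left at the end. -/
def survivors (c n g : ℕ) (rows : List (List Bool)) : List (List Bool) :=
  processRows g 0 rows ((initial c n g).flatMap (branch g [] []))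

/-- The sum of the numbers of subsets. -/
def weight (L : List (List Bool)) : ℕ := (L.map fun v => 2 ^ v.count true).sum

@[simp] theorem not_has_nil (k : ℕ) : ¬ Has [] k := by simp [Has]
@[simp] theorem has_cons_zero (b : Bool) (v : List Bool) : Has (b :: v) 0 ↔ b = true := by
  simp [Has]
@[simp] theorem has_cons_succ (b : Bool) (v : List Bool) (k : ℕ) :
    Has (b :: v) (k + 1) ↔ Has v k := by
  simp [Has]

@[simp] theorem del_nil (v : List Bool) : del v [] = v := by cases v <;> rfl
@[simp] theorem hit_nil (v : List Bool) : hit v [] = false := by cases v <;> rfl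
@[simp] theorem ins_nil (v : List Bool) : ins v [] = v := by cases v <;> rfl

@[simp] theorem length_del (v I : List Bool) : (del v I).length = v.length := by
  induction v generalizing I with
  | nil => rfl
  | cons b v ih => cases I <;> simp [del, ih]

@[simp] theorem length_ins (v I : List Bool) : (ins v I).length = v.length := by
  induction v generalizing I with
  | nil => rfl
  | cons b v ih => cases I <;> simp [ins, ih]

@[simp] theorem single_zero : single 0 = [true] := rfl
theorem single_succ (i : ℕ) : single (i + 1) = false :: single i := by
  simp [single, List.replicate_succ]

theorem hit_single (v : List Bool) (i : ℕ) : hit v (single i) = decide (Has v i) := by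
  induction v generalizing i with
  | nil => simp [hit]
  | cons b v ih =>
    cases i with
    | zero => simp [hit]
    | succ i => rw [single_succ, hit, ih]; simp

theorem has_del_single (v : List Bool) (i k : ℕ) :
    Has (del v (single i)) k ↔ Has v k ∧ k ≠ i := by
  induction v generalizing i k with
  | nil => simp [del]
  | cons b v ih =>
    cases i with
    | zero => cases k <;> simp [del]
    | succ i =>
      rw [single_succ, del]
      cases k with
      | zero => simp
      | succ k => simpa using ih i k

theorem has_ins_single (v : List Bool) {i k : ℕ} (hi : i < v.length) :
    Has (ins v (single i)) k ↔ Has v k ∨ k = i := by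
  induction v generalizing i k with
  | nil => simp at hi
  | cons b v ih =>
    cases i with
    | zero => cases k <;> simp [ins]
    | succ i =>
      rw [single_succ, ins]
      cases k with
      | zero => simp
      | succ k => simpa using ih (by simpa using hi)

theorem count_del_single (v : List Bool) {i : ℕ} (h : Has v i) :
    (del v (single i)).count true + 1 = v.count true := by
  induction v generalizing i with
  | nil => simp at h
  | cons b v ih =>
    cases i with
    | zero => simp at h; subst h; simp [del]
    | succ i =>
      rw [single_succ, del]
      have := ih (i := i) (by simpa using h)
      cases b <;> simp <;> omega

theorem count_ins_single_le (v : List Bool) (i : ℕ) :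
    (ins v (single i)).count true ≤ v.count true + 1 := by
  induction v generalizing i with
  | nil => simp [ins]
  | cons b v ih =>
    cases i with
    | zero => cases b <;> simp [ins]
    | succ i =>
      rw [single_succ, ins]
      have := ih i
      cases b <;> simp <;> omega

theorem card_filter_has (v : List Bool) :
    ((Finset.range v.length).filter (Has v)).card = v.count true := by
  rw [Finset.card_filter]
  induction v with
  | nil => rfl
  | cons b v ih =>
    rw [List.length_cons, Finset.sum_range_succ', List.count_cons, ← ih]
    cases b <;> simp

theorem lt_length_of_has {v : List Bool} {k : ℕ} (h : Has v k) : k < v.length := by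
  by_contra hk
  rw [Has, List.getD_eq_default _ _ (by omega)] at h
  cases h

theorem card_le_count {v : List Bool} {C : Finset ℕ} (h : ∀ a ∈ C, Has v a) :
    C.card ≤ v.count true := by
  rw [← card_filter_has]
  exact Finset.card_le_card fun a ha =>
    Finset.mem_filter.2 ⟨Finset.mem_range.2 (lt_length_of_has (h a ha)), h a ha⟩

/-! ### The sets left at the end have no conflicts -/

theorem mem_branch_nil {g : ℕ} {u v : List Bool} :
    u ∈ branch g [] [] v ↔ u = v ∧ g ≤ u.count true := by
  simp [branch]

theorem le_count_of_mem_branch {g : ℕ} {I J u v : List Bool} (h : u ∈ branch g I J v) :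
    g ≤ u.count true := by
  simpa using (List.mem_filter.1 h).2

/-- Soundness of one split: candidates only shrink, so a conflict once removed never comes back. -/
theorem of_mem_branch {g i j : ℕ} {u v : List Bool}
    (h : u ∈ branch g (single i) (single j) v) :
    u.length = v.length ∧ (∀ k, Has u k → Has v k) ∧ ¬ (Has u i ∧ Has u j) := by
  have h := (List.mem_filter.1 h).1
  rw [hit_single, hit_single] at h
  split_ifs at h with hij
  · simp only [List.mem_cons, List.not_mem_nil, or_false] at h
    rcases h with rfl | rfl <;> simp [has_del_single] <;> tauto
  · simp only [List.mem_cons, List.not_mem_nil, or_false] at h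
    subst h
    simpa using hij

/-- Completeness of one split: `C` misses `i` or `j`, so it survives the removal of that element.
The size filter keeps the resulting superset of `C`, as it has at least `C.card ≥ g` elements. -/
theorem exists_mem_branch {g i j : ℕ} {v : List Bool} {C : Finset ℕ} (hC : ∀ a ∈ C, Has v a)
    (hg : g ≤ C.card) (hij : ¬ (i ∈ C ∧ j ∈ C)) :
    ∃ u ∈ branch g (single i) (single j) v, ∀ a ∈ C, Has u a := by
  suffices ∃ u ∈ (if hit v (single i) && hit v (single j) then
      [del v (single i), del v (single j)] else [v]), ∀ a ∈ C, Has u a by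
    obtain ⟨u, hu, h⟩ := this
    exact ⟨u, List.mem_filter.2 ⟨hu, by simpa using hg.trans (card_le_count h)⟩, h⟩
  split_ifs with h
  · by_cases hi : i ∈ C
    · refine ⟨del v (single j), by simp, fun a ha => (has_del_single _ _ _).2 ⟨hC a ha, ?_⟩⟩
      rintro rfl
      exact hij ⟨hi, ha⟩
    · refine ⟨del v (single i), by simp, fun a ha => (has_del_single _ _ _).2 ⟨hC a ha, ?_⟩⟩
      rintro rfl
      exact hi ha
  · exact ⟨v, by simp, hC⟩

/-- The default value `true` in `getD` makes positions beyond the end of the row free of conflicts.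
The offset `j` is the column at which the remaining part of the row begins. -/
theorem of_mem_processRow {g i j : ℕ} {bs : List Bool} {L : List (List Bool)} {u : List Bool}
    (h : u ∈ processRow g i j bs L) : ∃ v ∈ L, u.length = v.length ∧ (∀ k, Has u k → Has v k) ∧
      ∀ k, bs.getD k true = false → ¬ (Has u i ∧ Has u (j + k)) := by
  induction bs generalizing j L with
  | nil => exact ⟨u, h, rfl, fun _ h => h, by simp⟩
  | cons b bs ih =>
    obtain ⟨v, hv, hl, hs, hc⟩ := ih h
    have hc' : ∀ k, bs.getD k true = false → ¬ (Has u i ∧ Has u (j + (k + 1))) := by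
      intro k hk
      rw [show j + (k + 1) = j + 1 + k by omega]
      exact hc k hk
    cases b with
    | true =>
      refine ⟨v, hv, hl, hs, fun k hk => ?_⟩
      cases k with
      | zero => simp at hk
      | succ k => exact hc' k (by simpa using hk)
    | false =>
      obtain ⟨w, hw, hv⟩ := List.mem_flatMap.1 hv
      obtain ⟨hl', hs', hc''⟩ := of_mem_branch hv
      refine ⟨w, hw, hl.trans hl', fun k hk => hs' k (hs k hk), fun k hk => ?_⟩
      cases k with
      | zero => exact fun h => hc'' ⟨hs _ h.1, hs _ h.2⟩
      | succ k => exact hc' k (by simpa using hk)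

theorem of_mem_processRows {g i : ℕ} {rs : List (List Bool)} {L : List (List Bool)}
    {u : List Bool} (h : u ∈ processRows g i rs L) :
    ∃ v ∈ L, u.length = v.length ∧ (∀ k, Has u k → Has v k) ∧
      ∀ r k, (rs.getD r []).getD k true = false → ¬ (Has u (i + r) ∧ Has u k) := by
  induction rs generalizing i L with
  | nil => exact ⟨u, h, rfl, fun _ h => h, by simp⟩
  | cons r rs ih =>
    obtain ⟨v, hv, hl, hs, hc⟩ := ih h
    obtain ⟨w, hw, hl', hs', hc'⟩ := of_mem_processRow hv
    refine ⟨w, hw, hl.trans hl', fun k hk => hs' k (hs k hk), fun r' k hk => ?_⟩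
    cases r' with
    | zero =>
      intro h
      refine hc' k (by simpa using hk) ⟨hs _ h.1, ?_⟩
      rw [zero_add]
      exact hs _ h.2
    | succ r' =>
      rw [show i + (r' + 1) = i + 1 + r' by omega]
      exact hc r' k (by simpa using hk)

theorem exists_mem_processRow {g i j : ℕ} {bs : List Bool} {L : List (List Bool)} {C : Finset ℕ}
    (hL : ∃ v ∈ L, ∀ a ∈ C, Has v a) (hg : g ≤ C.card)
    (hC : ∀ k, bs.getD k true = false → ¬ (i ∈ C ∧ j + k ∈ C)) :
    ∃ u ∈ processRow g i j bs L, ∀ a ∈ C, Has u a := by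
  induction bs generalizing j L with
  | nil => exact hL
  | cons b bs ih =>
    refine ih ?_ fun k hk => ?_
    · cases b with
      | true => exact hL
      | false =>
        obtain ⟨v, hv, h⟩ := hL
        obtain ⟨u, hu, h'⟩ := exists_mem_branch (g := g) h hg (hC 0 (by simp))
        exact ⟨u, List.mem_flatMap.2 ⟨v, hv, hu⟩, h'⟩
    · rw [show j + 1 + k = j + (k + 1) by omega]
      exact hC (k + 1) (by simpa using hk)

theorem exists_mem_processRows {g i : ℕ} {rs : List (List Bool)} {L : List (List Bool)}
    {C : Finset ℕ} (hL : ∃ v ∈ L, ∀ a ∈ C, Has v a) (hg : g ≤ C.card)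
    (hC : ∀ r k, (rs.getD r []).getD k true = false → ¬ (i + r ∈ C ∧ k ∈ C)) :
    ∃ u ∈ processRows g i rs L, ∀ a ∈ C, Has u a := by
  induction rs generalizing i L with
  | nil => exact hL
  | cons r rs ih =>
    refine ih (exists_mem_processRow hL hg fun k hk => ?_) fun r' k hk => ?_
    · rw [zero_add]
      exact hC 0 k (by simpa using hk)
    · rw [show i + 1 + r' = i + (r' + 1) by omega]
      exact hC (r' + 1) k (by simpa using hk)

theorem length_of_mem_rounds {n r : ℕ} {v : List Bool}
    (h : v ∈ (fun L => L.flatMap (expand n))^[r] [List.replicate n false]) : v.length = n := by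
  induction r generalizing v with
  | zero => simp at h; simp [h]
  | succ r ih =>
    rw [Function.iterate_succ_apply'] at h
    obtain ⟨w, hw, hv⟩ := List.mem_flatMap.1 h
    obtain ⟨i, -, rfl⟩ := List.mem_map.1 hv
    simpa using ih hw

theorem length_of_mem_initial {c n g : ℕ} {v : List Bool} (h : v ∈ initial c n g) :
    v.length = n := by
  rw [initial] at h
  split_ifs at h
  · exact length_of_mem_rounds h
  · simp at h; simp [h]

/-- One element of `C` is inserted per round, so exactly `C.card` rounds reach a candidate
containing it. -/
theorem exists_mem_rounds {n : ℕ} {C : Finset ℕ} (hC : ∀ a ∈ C, a < n) :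
    ∃ v ∈ (fun L => L.flatMap (expand n))^[C.card] [List.replicate n false],
      ∀ a ∈ C, Has v a := by
  induction C using Finset.induction_on with
  | empty => exact ⟨List.replicate n false, by simp, by simp⟩
  | insert a C ha ih =>
    obtain ⟨v, hv, h⟩ := ih fun b hb => hC b (Finset.mem_insert_of_mem hb)
    have hn := hC a (Finset.mem_insert_self _ _)
    rw [Finset.card_insert_of_notMem ha, Function.iterate_succ_apply']
    refine ⟨ins v (single a), List.mem_flatMap.2 ⟨v, hv, List.mem_map.2
      ⟨a, List.mem_range.2 hn, rfl⟩⟩, fun b hb => ?_⟩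
    rw [has_ins_single _ (by rwa [length_of_mem_rounds hv])]
    rcases Finset.mem_insert.1 hb with rfl | hb
    · exact .inr rfl
    · exact .inl (h b hb)

theorem exists_mem_initial {c n g : ℕ} {C : Finset ℕ} (hC : ∀ a ∈ C, a < n) (hg : C.card = g) :
    ∃ v ∈ initial c n g, ∀ a ∈ C, Has v a := by
  rw [initial]
  split_ifs
  · subst hg; exact exists_mem_rounds hC
  · refine ⟨_, List.mem_singleton_self _, fun a ha => ?_⟩
    have := hC a ha
    simp [Has, List.getD_eq_getElem?_getD, this]

/-! ### Few sets are alive at any time -/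

theorem weight_append (L L' : List (List Bool)) : weight (L ++ L') = weight L + weight L' := by
  simp [weight]

/-- This converts a bound on the potential into one on the number of candidates, and is the reason
for discarding small ones. -/
theorem length_mul_le_weight {g : ℕ} {L : List (List Bool)} (h : ∀ v ∈ L, g ≤ v.count true) :
    2 ^ g * L.length ≤ weight L := by
  induction L with
  | nil => simp
  | cons v L ih =>
    have h1 := ih fun u hu => h u (List.mem_cons_of_mem _ hu)
    have h2 : 2 ^ g ≤ 2 ^ v.count true := Nat.pow_le_pow_right (by norm_num) (h v (by simp))
    simp only [weight, List.map_cons, List.sum_cons, List.length_cons] at h1 ⊢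
    rw [mul_add]
    omega

theorem weight_filter_le (p : List Bool → Bool) (L : List (List Bool)) :
    weight (L.filter p) ≤ weight L := by
  induction L with
  | nil => simp
  | cons v L ih =>
    simp only [weight, List.filter_cons, List.map_cons, List.sum_cons] at ih ⊢
    split_ifs
    · simp only [List.map_cons, List.sum_cons]; omega
    · exact ih.trans (Nat.le_add_left _ _)

/-- Each replacement of `v` has exactly one element less, so two of them weigh together as much as
`v`. This includes `i = j`, a missing loop: the two replacements then coincide, and the duplicate is
harmless. -/
theorem weight_branch_le (g i j : ℕ) (v : List Bool) :
    weight (branch g (single i) (single j) v) ≤ 2 ^ v.count true := by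
  refine (weight_filter_le _ _).trans ?_
  rw [hit_single, hit_single]
  split_ifs with h
  · simp only [Bool.and_eq_true, decide_eq_true_eq] at h
    rw [← count_del_single v h.1]
    have : (del v (single j)).count true = (del v (single i)).count true := by
      have h1 := count_del_single v h.1
      have h2 := count_del_single v h.2
      omega
    simp [weight, this, pow_succ]
    omega
  · simp [weight]

theorem weight_flatMap_le {F : List Bool → List (List Bool)} {m : ℕ} {L : List (List Bool)}
    (h : ∀ v, weight (F v) ≤ m * 2 ^ v.count true) : weight (L.flatMap F) ≤ m * weight L := by
  induction L with
  | nil => simp [weight]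
  | cons v L ih =>
    rw [List.flatMap_cons, weight_append]
    have := h v
    simp only [weight, List.map_cons, List.sum_cons] at ih this ⊢
    rw [mul_add]
    omega

/-- All sets are subsets of `{0, …, n - 1}` with at least `g` elements, and there are at most `W`
of them, in a strong sense that `branch` preserves. -/
structure Good (n g W : ℕ) (L : List (List Bool)) : Prop where
  length_eq : ∀ v ∈ L, v.length = n
  le_count : ∀ v ∈ L, g ≤ v.count true
  weight_le : weight L ≤ 2 ^ g * W

theorem Good.length_le {n g W : ℕ} {L : List (List Bool)} (h : Good n g W L) : L.length ≤ W :=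
  Nat.le_of_mul_le_mul_left ((length_mul_le_weight h.le_count).trans h.weight_le) (by positivity)

theorem Good.flatMap_branch {n g W : ℕ} {L : List (List Bool)} (h : Good n g W L) (i j : ℕ) :
    Good n g W (L.flatMap (branch g (single i) (single j))) where
  length_eq u hu := by
    obtain ⟨v, hv, hu⟩ := List.mem_flatMap.1 hu
    rw [(of_mem_branch hu).1, h.length_eq v hv]
  le_count u hu := by
    obtain ⟨v, hv, hu⟩ := List.mem_flatMap.1 hu
    exact le_count_of_mem_branch hu
  weight_le := by
    have := weight_flatMap_le (m := 1) (L := L) fun v =>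
      (weight_branch_le g i j v).trans (one_mul _).ge
    rw [one_mul] at this
    exact this.trans h.weight_le

theorem Good.processRow {n g W : ℕ} {L : List (List Bool)} (h : Good n g W L) (i j : ℕ)
    (bs : List Bool) : Good n g W (processRow g i j bs L) := by
  induction bs generalizing j L with
  | nil => exact h
  | cons b bs ih =>
    refine ih ?_ _
    cases b
    · exact h.flatMap_branch i j
    · exact h

theorem Good.processRows {n g W : ℕ} {L : List (List Bool)} (h : Good n g W L) (i : ℕ)
    (rs : List (List Bool)) : Good n g W (processRows g i rs L) := by
  induction rs generalizing i L with
  | nil => exact h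
  | cons r rs ih => exact ih (h.processRow i 0 r) _

/-- A round multiplies the number of candidates by `n` and each `2 ^ |v|` by at most `2`. -/
theorem weight_rounds_le (n r : ℕ) :
    weight ((fun L => L.flatMap (expand n))^[r] [List.replicate n false]) ≤ (2 * n) ^ r := by
  induction r with
  | zero => simp [weight, List.count_replicate]
  | succ r ih =>
    rw [Function.iterate_succ_apply']
    refine (weight_flatMap_le (m := 2 * n) fun v => ?_).trans ?_
    · have : ∀ x ∈ (List.range n).map fun i => 2 ^ (ins v (single i)).count true,
          x ≤ 2 ^ (v.count true + 1) := by
        intro x hx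
        obtain ⟨i, -, rfl⟩ := List.mem_map.1 hx
        exact Nat.pow_le_pow_right (by norm_num) (count_ins_single_le v i)
      have := List.sum_le_card_nsmul _ _ this
      simp only [weight, expand, List.map_map, Function.comp_def]
      simp only [List.length_map, List.length_range, smul_eq_mul] at this
      calc _ ≤ _ := this
        _ = _ := by ring
    · rw [pow_succ, mul_comm]
      exact Nat.mul_le_mul_right _ ih

theorem length_rounds (n r : ℕ) :
    ((fun L => L.flatMap (expand n))^[r] [List.replicate n false]).length = n ^ r := by
  induction r with
  | zero => simp
  | succ r ih =>
    rw [Function.iterate_succ_apply', List.length_flatMap]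
    simp [expand, ih, pow_succ]

theorem good_filter_initial {c n g W : ℕ} (h : g ≤ c → n ^ g ≤ W)
    (h' : ¬ g ≤ c → g ≤ n → 2 ^ (n - g) ≤ W) :
    Good n g W ((initial c n g).flatMap (branch g [] [])) := by
  have hw : weight ((initial c n g).flatMap (branch g [] [])) ≤ weight (initial c n g) := by
    have := weight_flatMap_le (m := 1) (L := initial c n g) (F := branch g [] []) fun v =>
      (weight_filter_le _ _).trans (by simp [weight])
    rwa [one_mul] at this
  refine ⟨fun u hu => ?_, fun u hu => ?_, ?_⟩
  · obtain ⟨v, hv, hu⟩ := List.mem_flatMap.1 hu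
    rw [(mem_branch_nil.1 hu).1, length_of_mem_initial hv]
  · obtain ⟨v, hv, hu⟩ := List.mem_flatMap.1 hu
    exact le_count_of_mem_branch hu
  · by_cases hgc : g ≤ c
    · refine hw.trans ?_
      rw [initial, if_pos hgc]
      refine (weight_rounds_le n g).trans ?_
      rw [mul_pow]
      exact Nat.mul_le_mul_left _ (h hgc)
    · by_cases hgn : g ≤ n
      · refine hw.trans ?_
        rw [initial, if_neg hgc]
        calc weight [List.replicate n true] = 2 ^ g * 2 ^ (n - g) := by
              rw [← pow_add, Nat.add_sub_cancel' hgn]; simp [weight]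
          _ ≤ _ := Nat.mul_le_mul_left _ (h' hgc hgn)
      -- For `g > n` the full set itself fails the size filter, so the family is empty.
      · rw [initial, if_neg hgc]
        simp [branch, weight, hgn]

/-- Some set survives if and only if there is a set of `g` numbers without conflicts. -/
theorem survivors_ne_nil_iff {c n g : ℕ} {rel : Fin n → Fin n → Bool} :
    survivors c n g ((List.finRange n).map fun i => (List.finRange n).map fun j => rel i j) ≠ [] ↔
      ∃ A : Finset (Fin n), g ≤ A.card ∧ ∀ a ∈ A, ∀ b ∈ A, rel a b = true := by
  have hrel : ∀ (a b : ℕ), (((List.finRange n).map fun i => (List.finRange n).map fun j =>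
      rel i j).getD a []).getD b true = false ↔
        ∃ (ha : a < n) (hb : b < n), rel ⟨a, ha⟩ ⟨b, hb⟩ = false := by
    intro a b
    by_cases ha : a < n
    · by_cases hb : b < n
      · simp [List.getD_eq_getElem?_getD, ha, hb]
      · simp [List.getD_eq_getElem?_getD, ha, hb]
    · simp [List.getD_eq_getElem?_getD, ha]
  constructor
  · intro h
    obtain ⟨u, hu⟩ := List.exists_mem_of_ne_nil _ h
    -- Correctness uses only the lengths and cardinalities recorded in `Good`; the value of `W` is
    -- chosen merely to meet both side conditions.
    have hgood : ∀ rs, Good n g (n ^ g + 2 ^ (n - g)) (survivors c n g rs) := fun rs =>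
      (good_filter_initial (c := c) (fun _ => Nat.le_add_right _ _) fun _ _ =>
        Nat.le_add_left _ _).processRows 0 rs
    obtain ⟨v, hv, hl, hs, hc⟩ := of_mem_processRows hu
    have hlu := (hgood _).length_eq u hu
    refine ⟨Finset.univ.filter fun a => Has u a, ?_, fun a ha b hb => ?_⟩
    · refine ((hgood _).le_count u hu).trans ?_
      rw [← card_filter_has, hlu, Finset.card_filter, Finset.card_filter, Finset.sum_range]
    · by_contra hab
      have := hc a b ((hrel a b).2 ⟨a.2, b.2, by simpa using hab⟩)
      rw [zero_add] at this
      exact this ⟨(Finset.mem_filter.1 ha).2, (Finset.mem_filter.1 hb).2⟩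
  · rintro ⟨A, hA, h⟩
    -- The solution is cut down to exactly `g` elements, because for small `g` the initial family is
    -- built by exactly `g` insertions.
    obtain ⟨B, hB, hg⟩ := Finset.exists_subset_card_eq hA
    have hC : ∀ a ∈ B.map Fin.valEmbedding, a < n := by
      intro a ha
      obtain ⟨b, -, rfl⟩ := Finset.mem_map.1 ha
      exact b.2
    obtain ⟨v, hv, hvC⟩ := exists_mem_initial (c := c) hC (g := g) (by simpa using hg)
    obtain ⟨u, hu, -⟩ := exists_mem_processRows (g := g) (i := 0)
      (rs := (List.finRange n).map fun i => (List.finRange n).map fun j => rel i j)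
      (L := (initial c n g).flatMap (branch g [] [])) (C := B.map Fin.valEmbedding)
      ⟨v, List.mem_flatMap.2 ⟨v, hv, mem_branch_nil.2 ⟨rfl, by
        simpa [hg] using card_le_count hvC⟩⟩, hvC⟩ (by simp [hg]) (by
        intro r k hrk ⟨hr, hk⟩
        obtain ⟨hr', hk', hrk⟩ := (hrel r k).1 hrk
        rw [zero_add] at hr
        obtain ⟨r, hrB, rfl⟩ := Finset.mem_map.1 hr
        obtain ⟨k, hkB, rfl⟩ := Finset.mem_map.1 hk
        exact Bool.false_ne_true (hrk.symm.trans (h r (hB hrB) k (hB hkB))))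
    exact List.ne_nil_of_mem hu

end Mask

/-! ### Basic programs: moving stacks, reading the header, decoding binary numbers -/

/-- The number `n` in unary. -/
abbrev ones (n : ℕ) : List Bool := List.replicate n true

theorem ones_succ (n : ℕ) : ones (n + 1) = true :: ones n := rfl

section Basic

variable {R : List Bool → List Bool → ℕ → Prop}

theorem Exec.of_eq {p : Prog} {s s₁ s' : Store} {t₁ t : ℕ} (h : Exec R p s s₁ t₁) (hs : s₁ = s')
    (ht : t₁ ≤ t) : Exec R p s s' t :=
  hs ▸ h.weaken ht

theorem Exec.of_start {p : Prog} {s s₁ s' : Store} {t : ℕ} (h : Exec R p s₁ s' t) (hs : s = s₁) :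
    Exec R p s s' t :=
  hs ▸ h

namespace Prog

/-- Pour one stack onto another. -/
def move (k j : Stk) : Prog := loop k fun b => push j b

/-- Empty a stack. -/
def clear (k : Stk) : Prog := loop k fun _ => skip

end Prog

open Prog

theorem exec_move {k j : Stk} (hkj : j ≠ k) (l : List Bool) (s : Store) (h : s.get k = l) :
    Exec R (move k j) s ((s.set k []).set j (l.reverse ++ s.get j)) (2 * l.length + 1) := by
  induction l generalizing s with
  | nil =>
    refine (Exec.loop_nil h).of_eq ?_ le_rfl
    rw [← h, Store.set_get, h, List.reverse_nil, List.nil_append, Store.set_get]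
  | cons b l ih =>
    refine (Exec.loop_cons h (.push j b _) (ih _ ?_)).of_eq ?_ ?_
    · simp [hkj.symm]
    · rw [Store.set_comm _ hkj.symm]
      simp [hkj]
    · simp; omega

theorem exec_clear {k : Stk} (l : List Bool) (s : Store) (h : s.get k = l) :
    Exec R (clear k) s (s.set k []) (2 * l.length + 1) := by
  induction l generalizing s with
  | nil => exact (Exec.loop_nil h).of_eq (by simp [← h]) le_rfl
  | cons b l ih =>
    refine (Exec.loop_cons h (.skip _) (ih _ ?_)).of_eq ?_ ?_
    · simp
    · simp
    · simp; omega

/-- A loop controlled by a unary number, given the stores between its rounds. -/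
theorem exec_loop_ones {k : Stk} {p : Bool → Prog} {T : ℕ} {s s' : Store} (n : ℕ) (σ : ℕ → Store)
    (h0 : σ 0 = s) (hn : σ n = s') (h : ∀ i, i ≤ n → (σ i).get k = ones (n - i))
    (hp : ∀ i, i < n → Exec R (p true) ((σ i).set k (ones (n - (i + 1)))) (σ (i + 1)) T) :
    Exec R (loop k p) s s' (n * (T + 1) + 1) := by
  subst h0 hn
  induction n generalizing σ with
  | zero => exact (Exec.loop_nil (h 0 le_rfl)).of_eq rfl (by omega)
  | succ n ih =>
    refine (Exec.loop_cons (h 0 (Nat.zero_le _)) (hp 0 (Nat.succ_pos _))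
      (ih (fun i => σ (i + 1)) (fun i hi => ?_) fun i hi => ?_)).of_eq rfl ?_
    · rw [h (i + 1) (by omega), Nat.add_sub_add_right]
    · have := hp (i + 1) (by omega)
      rwa [Nat.add_sub_add_right] at this
    · rw [Nat.succ_mul]; omega

namespace Prog

/-- Split off the header of the input: put the size of the model, in unary, on the stacks `len`,
`rows`, `cols` and `arg`. -/
def readHeader : Prog :=
  loop .inp (fun b => case .mark
    (if b then push .len true ;; push .rows true ;; push .cols true ;; push .arg true
      else push .mark true)
    fun m => push .mark m ;; push .aux b) ;;
  clear .mark ;; move .aux .inp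

end Prog

theorem exec_readHeader (n : ℕ) (l : List Bool) :
    Exec R readHeader { inp := ones n ++ false :: l }
      { inp := l, len := ones n, rows := ones n, cols := ones n, arg := ones n }
      (6 * n + 6 * l.length + 8) := by
  -- The stack `mark` is a flag for having passed the separator. While it is nonempty the loop
  -- copies matrix entries to `aux`, upside down; the final `move` restores their order.
  have h1 : ∀ (l : List Bool) (s : Store), s.inp = l → s.mark = [true] →
      Exec R (loop .inp fun b => case .mark
        (if b then push .len true ;; push .rows true ;; push .cols true ;; push .arg true
          else push .mark true)
        fun m => push .mark m ;; push .aux b) s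
        ((s.set .inp []).set .aux (l.reverse ++ s.get .aux)) (4 * l.length + 1) := by
    intro l
    induction l with
    | nil =>
      refine fun s h _ => (Exec.loop_nil (k := .inp) h).of_eq ?_ le_rfl
      simp [Store.ext_iff, Store.get, Store.set, h]
    | cons b l ih =>
      intro s h hm
      refine (Exec.loop_cons (k := .inp) h (.case_cons (k := .mark) (s := s.set .inp l) (b := true)
        (l := []) hm
        (.seq (.push _ _ _) (.push _ _ _))) (ih _ rfl rfl)).of_eq ?_ ?_
      · simp [Store.get, Store.set, hm]
      · simp; omega
  have h2 : ∀ (n m : ℕ), Exec R (loop .inp fun b => case .mark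
        (if b then push .len true ;; push .rows true ;; push .cols true ;; push .arg true
          else push .mark true)
        fun m => push .mark m ;; push .aux b)
        { inp := ones n ++ false :: l, len := ones m, rows := ones m, cols := ones m,
          arg := ones m }
        { aux := l.reverse, mark := [true], len := ones (n + m), rows := ones (n + m),
          cols := ones (n + m), arg := ones (n + m) } (6 * n + 4 * l.length + 4) := by
    intro n
    induction n with
    | zero =>
      intro m
      refine (Exec.loop_cons (b := false) (l := l) rfl (.case_nil rfl (.push _ _ _))
        (h1 l _ rfl rfl)).of_eq ?_ (by omega)
      simp [Store.get, Store.set, Store.get, Store.set]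
    | succ n ih =>
      intro m
      refine (Exec.loop_cons (b := true) (l := ones n ++ false :: l) rfl (.case_nil rfl
        (.seq (.push _ _ _) (.seq (.push _ _ _) (.seq (.push _ _ _) (.push _ _ _)))))
        (ih (m + 1))).of_eq ?_ (by omega)
      rw [show n + (m + 1) = n + 1 + m by omega]
  refine (Exec.seq (h2 n 0) (.seq (exec_clear [true] _ rfl)
    (exec_move (by decide) l.reverse _ rfl))).of_eq ?_ (by simp; omega)
  simp [Store.get, Store.set, Store.get, Store.set]

namespace Prog

/-- Double the number on `thr` and add a bit, truncating at the value of `len` plus one. -/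
def decodeStep (b : Bool) : Prog :=
  loop .thr (fun _ => push .tmp true ;; push .tmp true) ;;
  (if b then push .tmp true else skip) ;;
  loop .len (fun _ => push .len' true ;; case .tmp skip fun _ => push .thr true) ;;
  case .tmp skip (fun _ => push .thr true) ;;
  move .len' .len ;; clear .tmp

/-- Convert the binary number on `res`, top bit on top, to unary, truncated at the value of `len`
plus one. -/
def decode : Prog := loop .res decodeStep

end Prog

/-- The number `2 * a + b` is built on `tmp`. The `n` rounds of the loop on `len` carry at most `n`
units of it back to `thr`, one further `case` carries the unit number `n + 1`, and the excess is
cleared. -/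
theorem exec_decodeStep (n : ℕ) (b : Bool) (a : ℕ) (ha : a ≤ n + 1) (s : Store)
    (hn : s.len = ones n) (hn' : s.len' = [])
    (ht : s.tmp = []) (hthr : s.thr = ones a) :
    Exec R (decodeStep b) s (s.set .thr (ones (min (2 * a + b.toNat) (n + 1)))) (15 * n + 20) := by
  have h1 : Exec R (loop .thr fun _ => push .tmp true ;; push .tmp true) s
      ((s.set .thr []).set .tmp (ones (2 * a))) (a * (2 + 1) + 1) := by
    refine exec_loop_ones a (fun i => (s.set .thr (ones (a - i))).set .tmp
      (ones (2 * i))) ?_ ?_ (fun i _ => by simp) fun i hi =>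
      (Exec.seq (.push .tmp true _) (.push .tmp true _)).of_eq ?_ le_rfl
    · simp [Store.ext_iff, Store.set, ht, hthr]
    · simp
    · simp [Store.get, Store.set, mul_add, ones_succ]
  have h2 : Exec R (if b then push .tmp true else skip)
      ((s.set .thr []).set .tmp (ones (2 * a)))
      ((s.set .thr []).set .tmp (ones (2 * a + b.toNat))) 1 := by
    cases b
    · exact .skip _
    · refine (Exec.push .tmp true _).of_eq ?_ le_rfl
      simp [ones_succ]
  have h3 : Exec R (loop .len fun _ => push .len' true ;; case .tmp skip fun _ => push .thr true)
      ((s.set .thr []).set .tmp (ones (2 * a + b.toNat)))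
      ((((s.set .thr (ones (min (2 * a + b.toNat) n))).set .tmp
        (ones (2 * a + b.toNat - n))).set .len []).set .len' (ones n)) (n * (3 + 1) + 1) := by
    refine exec_loop_ones n (fun i => ((((s.set .thr
      (ones (min (2 * a + b.toNat) i))).set .tmp
        (ones (2 * a + b.toNat - i))).set .len (ones (n - i))).set .len' (ones i)))
        ?_ ?_ (fun i _ => by simp) fun i hi => ?_
    · simp [Store.set, hn, hn']
    · simp
    · obtain h | ⟨m, hm⟩ : 2 * a + b.toNat ≤ i ∨ ∃ m, 2 * a + b.toNat = i + (m + 1) := by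
        by_cases h : 2 * a + b.toNat ≤ i
        · exact .inl h
        · exact .inr ⟨2 * a + b.toNat - i - 1, by omega⟩
      · refine (Exec.seq (.push .len' true _) (.case_nil ?_ (.skip _))).of_eq ?_ le_rfl
        · simp [h]
        · simp [Store.get, Store.set, ones_succ, h, Nat.sub_eq_zero_of_le,
            (show 2 * a + b.toNat ≤ i + 1 by omega)]
      · refine (Exec.seq (.push .len' true _) (.case_cons (p := fun _ => push .thr true) (b := true)
          (l := ones m) ?_ (.push .thr true _))).of_eq ?_ le_rfl
        · simp [hm, ones_succ]
        · simp [Store.get, Store.set, ones_succ, hm, show i + (m + 1) - (i + 1) = m by omega]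
  have h4 : Exec R (case .tmp skip fun _ => push .thr true)
      ((((s.set .thr (ones (min (2 * a + b.toNat) n))).set .tmp
        (ones (2 * a + b.toNat - n))).set .len []).set .len' (ones n))
      ((((s.set .thr (ones (min (2 * a + b.toNat) (n + 1)))).set .tmp
        (ones (2 * a + b.toNat - (n + 1)))).set .len []).set .len' (ones n)) 2 := by
    obtain h | ⟨m, hm⟩ : 2 * a + b.toNat ≤ n ∨ ∃ m, 2 * a + b.toNat = n + (m + 1) := by
      by_cases h : 2 * a + b.toNat ≤ n
      · exact .inl h
      · exact .inr ⟨2 * a + b.toNat - n - 1, by omega⟩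
    · refine (Exec.case_nil ?_ (.skip _)).of_eq ?_ le_rfl
      · simp [h]
      · simp [Store.set, h, Nat.sub_eq_zero_of_le, (show 2 * a + b.toNat ≤ n + 1 by omega)]
    · refine (Exec.case_cons (p := fun _ => push .thr true) (b := true) (l := ones m) ?_
        (.push .thr true _)).of_eq ?_ le_rfl
      · simp [hm, ones_succ]
      · simp [Store.get, Store.set, ones_succ, hm, show n + (m + 1) - (n + 1) = m by omega]
  refine (Exec.seq h1 (.seq h2 (.seq h3 (.seq h4 (.seq
    (exec_move (by decide) (ones n) _ (by simp))
    (exec_clear (ones (2 * a + b.toNat - (n + 1))) _ (by simp))))))).of_eq ?_ ?_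
  · simp [Store.get, Store.set, hn, hn', ht]
  · have : b.toNat ≤ 1 := b.toNat_le
    simp only [List.length_replicate]
    omega

theorem exec_decode (n : ℕ) (l : List Bool) (a : ℕ) (ha : a ≤ n + 1) (s : Store)
    (hl : s.res = l) (hn : s.len = ones n) (hn' : s.len' = [])
    (ht : s.tmp = []) (hthr : s.thr = ones a) :
    Exec R decode s ((s.set .res []).set .thr
      (ones (l.foldl (fun a b => min (2 * a + b.toNat) (n + 1)) a)))
      (l.length * (15 * n + 21) + 1) := by
  induction l generalizing s a with
  | nil =>
    refine (Exec.loop_nil (k := .res) hl).of_eq ?_ (by omega)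
    simp [Store.ext_iff, Store.set, hl, hthr]
  | cons b l ih =>
    refine (Exec.loop_cons (k := .res) hl (exec_decodeStep n b a ha _ ?_ ?_ ?_ ?_)
      (ih (min (2 * a + b.toNat) (n + 1)) (min_le_right _ _) _ ?_ ?_ ?_ ?_ ?_)).of_eq ?_ ?_
    · simpa [Store.get, Store.set] using hn
    · simpa [Store.get, Store.set] using hn'
    · simpa [Store.get, Store.set] using ht
    · simpa [Store.get, Store.set] using hthr
    · simp [Store.set]
    · simpa [Store.get, Store.set] using hn
    · simpa [Store.get, Store.set] using hn'
    · simpa [Store.get, Store.set] using ht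
    · simp [Store.set]
    · simp [Store.set]
    · rw [List.length_cons, add_mul]
      omega

end Basic

/-! ### Families of sets on a stack, and the program for the initial family -/

namespace Mask

/-- A list of sets as the contents of a stack. -/
def enc (L : List (List Bool)) : List Bool := L.flatMap fun v => true :: v

@[simp] theorem enc_nil : enc [] = [] := rfl
@[simp] theorem enc_cons (v : List Bool) (L : List (List Bool)) :
    enc (v :: L) = true :: (v ++ enc L) := rfl
@[simp] theorem enc_append (L L' : List (List Bool)) : enc (L ++ L') = enc L ++ enc L' := by
  simp [enc]

/-- Each set is preceded by a `true`, which only announces a further record. No terminator is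
needed, because all sets have length `n` and are read off by counting along `len`. -/
theorem length_enc {n : ℕ} {L : List (List Bool)} (h : ∀ v ∈ L, v.length = n) :
    (enc L).length = L.length * (n + 1) := by
  induction L with
  | nil => simp
  | cons v L ih =>
    have h1 := ih fun u hu => h u (List.mem_cons_of_mem _ hu)
    have h2 := h v (by simp)
    simp only [enc_cons, List.length_cons, List.length_append, h1, h2, add_mul]
    omega

end Mask

open Mask

section Initial

variable {R : List Bool → List Bool → ℕ → Prop}

namespace Prog

/-- Put a single set on `fro`: the empty or the full one. -/
def fill (b : Bool) : Prog :=
  loop .len (fun _ => push .len' true ;; push .fro b) ;; push .fro true ;; move .len' .len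

/-- Add the set on `one` to the set on `buf`; the result appears on `fro'`, upside down. -/
def insWalk : Prog :=
  loop .buf fun v => push .buf' v ;;
    case .one (push .fro' v) fun b => push .one' b ;; push .fro' (v || b)

/-- Put one of the sets of `Mask.expand` on `fro'` and proceed to the next one. -/
def insStep : Prog :=
  push .len true ;; push .fro' true ;; insWalk ;; move .buf' .buf ;; move .one' .one ;;
    push .one false

/-- Move a set from `fro` to `buf'`. -/
def readRecord : Prog :=
  loop .len fun _ => push .len' true ;; case .fro skip fun v => push .buf' v

/-- Take a set from `fro` and put all sets of `Mask.expand` on `fro'`. -/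
def expandRecord : Prog :=
  readRecord ;; move .buf' .buf ;; push .one true ;; loop .len' (fun _ => insStep) ;;
    clear .buf ;; clear .one

/-- Replace each set on `fro` by the sets of `Mask.expand`. -/
def expandAll : Prog := loop .fro (fun _ => expandRecord) ;; move .fro' .fro

/-- Pop at most `c` elements from `tmp`. -/
def dropTmp : ℕ → Prog
  | 0 => skip
  | c + 1 => case .tmp skip (fun _ => skip) ;; dropTmp c

/-- Put the sets of `Mask.initial` on `fro`. -/
def initFrontier (c : ℕ) : Prog :=
  loop .thr (fun _ => push .tmp true ;; push .thr' true ;; push .buf true) ;; move .buf .thr ;;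
    dropTmp c ;;
    case .tmp (fill false ;; loop .thr' fun _ => expandAll)
      fun _ => clear .tmp ;; clear .thr' ;; fill true

end Prog

open Prog

theorem exec_fill (n : ℕ) (b : Bool) (s : Store) (hn : s.len = ones n) (hn' : s.len' = [])
    (hf : s.fro = []) :
    Exec R (fill b) s (s.set .fro (true :: List.replicate n b)) (5 * n + 3) := by
  have h1 : Exec R (loop .len fun _ => push .len' true ;; push .fro b) s
      (((s.set .len []).set .len' (ones n)).set .fro (List.replicate n b)) (n * (2 + 1) + 1) := by
    refine exec_loop_ones n (fun i => ((s.set .len (ones (n - i))).set .len' (ones i)).set .fro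
      (List.replicate i b)) ?_ ?_ (fun i _ => rfl) fun i hi =>
        (Exec.seq (.push .len' true _) (.push .fro b _)).of_eq ?_ le_rfl
    · simp [Store.ext_iff, Store.set, hn, hn', hf]
    · simp
    · simp [Store.get, Store.set, List.replicate_succ]
  refine (Exec.seq h1 (.seq (.push .fro true _) (exec_move (by decide) (ones n) _ rfl))).of_eq ?_ ?_
  · simp [Store.get, Store.set, hn, hn']
  · simp only [List.length_replicate]; omega

theorem exec_insWalk (v I : List Bool) (s : Store) (hv : s.buf = v) (hI : s.one = I) :
    Exec R insWalk s (((((s.set .buf []).set .buf' (v.reverse ++ s.buf')).set .one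
      (I.drop v.length)).set .one' ((I.take v.length).reverse ++ s.one')).set .fro'
        ((ins v I).reverse ++ s.fro')) (5 * v.length + 1) := by
  induction v generalizing s I with
  | nil =>
    refine (Exec.loop_nil (k := .buf) hv).of_eq ?_ (by simp)
    simp [Store.ext_iff, Store.set, hv, hI, ins]
  | cons v vs ih =>
    cases I with
    | nil =>
      refine (Exec.loop_cons (k := .buf) hv (.seq (.push .buf' v _)
        (.case_nil (k := .one) (by exact hI) (.push .fro' v _))) (ih [] _ (by rfl)
          (by exact hI))).of_eq ?_ ?_
      · simp [Store.get, Store.set, ins]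
      · rw [List.length_cons]; omega
    | cons b I =>
      refine (Exec.loop_cons (k := .buf) hv (.seq (.push .buf' v _) (.case_cons (k := .one)
        (p := fun b => push .one' b ;; push .fro' (v || b)) (b := b) (l := I) (by exact hI)
        (.seq (.push .one' b _) (.push .fro' (v || b) _)))) (ih I _ (by rfl) (by rfl))).of_eq ?_ ?_
      · simp [Store.get, Store.set, ins]
      · rw [List.length_cons]; omega

/-- Pushing `false` onto `one` turns `single i` into `single (i + 1)`, so successive steps run
through all singletons, and the unit pushed onto `len` restores the counter that `readRecord` had
drained. -/
theorem exec_insStep (v I : List Bool) (s : Store) (hv : s.buf = v) (hv' : s.buf' = [])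
    (hI : s.one = I) (hI' : s.one' = []) :
    Exec R insStep s (((s.set .len (true :: s.len)).set .fro'
      ((ins v I).reverse ++ true :: s.fro')).set .one (false :: I)) (9 * v.length + 6) := by
  refine (Exec.seq (.push .len true _) (.seq (.push .fro' true _) (.seq
    (exec_insWalk v I _ hv hI) (.seq (exec_move (by decide) v.reverse _ ?_) (.seq
    (exec_move (by decide) (I.take v.length).reverse _ ?_) (.push .one false _)))))).of_eq ?_ ?_
  · simp [Store.get, Store.set, hv']
  · simp [Store.get, Store.set, hI']
  · simp [Store.get, Store.set, hv', hv, hI']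
  · simp only [List.length_reverse, List.length_take]; omega

theorem exec_readRecord (v rest : List Bool) (m : ℕ) (s : Store) (hn : s.len = ones v.length)
    (hm : s.len' = ones m) (hv : s.fro = v ++ rest) :
    Exec R readRecord s ((((s.set .len []).set .len' (ones (v.length + m))).set .fro rest).set .buf'
      (v.reverse ++ s.buf')) (4 * v.length + 1) := by
  induction v generalizing s m with
  | nil =>
    refine (Exec.loop_nil (k := .len) hn).of_eq ?_ (by simp)
    simp only [List.length_nil] at hn
    simp [Store.ext_iff, Store.set, hn, hm, hv]
  | cons v vs ih =>
    refine (Exec.loop_cons (k := .len) (b := true) (l := ones vs.length) hn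
      (.seq (.push .len' true _) (.case_cons (k := .fro) (p := fun v => push .buf' v)
        (b := v) (l := vs ++ rest) (by exact hv) (.push .buf' v _)))
      (ih (m + 1) _ (by rfl) (by simp [Store.get, Store.set, hm, ones_succ]) (by rfl))).of_eq ?_ ?_
    · simp [Store.get, Store.set]; omega
    · rw [List.length_cons]; omega

theorem exec_expandRecord (v rest X : List Bool) (s : Store) (hn : s.len = ones v.length)
    (hn' : s.len' = []) (hv : s.fro = v ++ rest) (hX : s.fro' = X) (hb : s.buf = [])
    (hb' : s.buf' = []) (ho : s.one = []) (ho' : s.one' = []) :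
    Exec R expandRecord s
      ((s.set .fro rest).set .fro' ((enc (expand v.length v)).reverse ++ X))
      (9 * v.length ^ 2 + 17 * v.length + 8) := by
  have h1 : Exec R (loop .len' fun _ => insStep)
      (((((s.set .len []).set .len' (ones v.length)).set .fro rest).set .buf v).set .one [true])
      (((((s.set .len' []).set .fro rest).set .buf v).set .one (single v.length)).set .fro'
        ((enc (expand v.length v)).reverse ++ X))
      (v.length * (9 * v.length + 6 + 1) + 1) := by
    refine exec_loop_ones v.length (fun i => ((((((s.set .len (ones i)).set .len'
      (ones (v.length - i))).set .fro rest).set .buf v).set .one (single i)).set .fro'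
        ((enc ((List.range i).map fun i => ins v (single i))).reverse ++ X))) ?_ ?_
        (fun i _ => rfl) fun i hi =>
        (exec_insStep v (single i) _ rfl ?_ rfl ?_).of_eq ?_ le_rfl
    · simp [Store.set, hX]
    · simp [Store.set, hn, expand]
    · simpa [Store.set] using hb'
    · simpa [Store.set] using ho'
    · simp [Store.set, single_succ, List.range_succ, ones_succ]
  refine (Exec.seq (exec_readRecord v rest 0 s hn hn' hv) (.seq
    (exec_move (by decide) v.reverse _ (by simp [Store.get, Store.set, hb']))
    (.seq (.push .one true _) (.seq (h1.of_start ?_) (.seq (exec_clear v _ rfl)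
    (exec_clear (single v.length) _ rfl)))))).of_eq ?_ ?_
  · simp [Store.get, Store.set, hb, hb', ho]
  · simp [Store.set, hb, ho, hn']
  · simp [single]
    ring_nf
    omega

theorem exec_expandAll_loop {n : ℕ} (L : List (List Bool)) (hL : ∀ v ∈ L, v.length = n)
    (X : List Bool) (s : Store) (hn : s.len = ones n)
    (hn' : s.len' = []) (hf : s.fro = enc L) (hX : s.fro' = X) (hb : s.buf = [])
    (hb' : s.buf' = []) (ho : s.one = []) (ho' : s.one' = []) :
    Exec R (loop .fro fun _ => expandRecord) s
      ((s.set .fro []).set .fro' ((enc (L.flatMap (expand n))).reverse ++ X))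
      (L.length * (9 * n ^ 2 + 17 * n + 9) + 1) := by
  induction L generalizing s X with
  | nil =>
    refine (Exec.loop_nil (k := .fro) hf).of_eq ?_ (by simp)
    simp [Store.ext_iff, Store.set, hf, hX]
  | cons v L ih =>
    have hv := hL v (by simp)
    subst hv
    refine (Exec.loop_cons (k := .fro) (b := true) (l := v ++ enc L) hf
      (exec_expandRecord v (enc L) X _ (by exact hn) (by exact hn') (by rfl) (by exact hX)
        (by exact hb) (by exact hb') (by exact ho) (by exact ho'))
      (ih (fun u hu => hL u (List.mem_cons_of_mem _ hu)) _ _ (by exact hn) (by exact hn') (by rfl)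
        (by rfl) (by exact hb) (by exact hb') (by exact ho) (by exact ho'))).of_eq
        ?_ ?_
    · simp [Store.set]
    · simp only [List.length_cons, add_mul, one_mul]; omega

theorem exec_expandAll {n : ℕ} (L : List (List Bool)) (hL : ∀ v ∈ L, v.length = n)
    (s : Store) (hn : s.len = ones n)
    (hn' : s.len' = []) (hf : s.fro = enc L) (hX : s.fro' = []) (hb : s.buf = [])
    (hb' : s.buf' = []) (ho : s.one = []) (ho' : s.one' = []) :
    Exec R expandAll s (s.set .fro (enc (L.flatMap (expand n))))
      (L.length * (20 * (n + 1) ^ 2) + 2) := by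
  refine (Exec.seq (exec_expandAll_loop L hL [] s hn hn' hf hX hb hb' ho ho')
    (exec_move (by decide) (enc (L.flatMap (expand n))).reverse _
      (by simp [Store.get, Store.set]))).of_eq ?_ ?_
  · simp [Store.get, Store.set, hX]
  · have h1 : ∀ u ∈ L.flatMap (expand n), u.length = n := by
      intro u hu
      obtain ⟨v, hv, hu⟩ := List.mem_flatMap.1 hu
      obtain ⟨i, -, rfl⟩ := List.mem_map.1 hu
      simpa using hL v hv
    have h2 : (L.flatMap (expand n)).length = L.length * n := by
      simp [List.length_flatMap, expand]
    rw [List.length_reverse, length_enc h1, h2]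
    nlinarith [Nat.zero_le (L.length * n), Nat.zero_le (L.length * n ^ 2), Nat.zero_le L.length]

theorem exec_dropTmp (c a : ℕ) (s : Store) (h : s.tmp = ones a) :
    Exec R (dropTmp c) s (s.set .tmp (ones (a - c))) (2 * c + 1) := by
  induction c generalizing s a with
  | zero =>
    refine (Exec.skip s).of_eq ?_ le_rfl
    simp [Store.ext_iff, Store.set, h]
  | succ c ih =>
    cases a with
    | zero =>
      refine (Exec.seq (.case_nil (k := .tmp) h (.skip _)) (ih 0 s h)).of_eq ?_ (by omega)
      simp
    | succ a =>
      refine (Exec.seq (.case_cons (k := .tmp) (b := true) (l := ones a) h (.skip _))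
        (ih a _ rfl)).of_eq ?_ (by omega)
      simp [Nat.add_sub_add_right]

/-- The stores in the main part of the program. -/
def Store.main (n g : ℕ) (inp rows cols cols' fro fro' one two : List Bool) : Store :=
  { inp, rows, cols, cols', fro, fro', one, two, len := ones n, thr := ones g }

/-- The test `g ≤ c` is made by dropping `c` units from a copy of `g` and looking whether any are
left. The constant `c` is built into the program, so the exponent `c + 2` still gives a polynomial
in `n`. -/
theorem exec_initFrontier (c n g : ℕ) (hg : g ≤ n + 1) (inp rows cols : List Bool) :
    Exec R (initFrontier c) (.main n g inp rows cols [] [] [] [] [])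
      (.main n g inp rows cols [] (enc (initial c n g)) [] [] [])
      (20 * n + 2 * c + 30 + c * (20 * (n + 1) ^ (c + 2) + 3)) := by
  have h1 : Exec R (loop .thr fun _ => push .tmp true ;; push .thr' true ;; push .buf true)
      (.main n g inp rows cols [] [] [] [] [])
      { inp, rows, cols, len := ones n, tmp := ones g, thr' := ones g, buf := ones g }
      (g * (3 + 1) + 1) := by
    refine exec_loop_ones g (fun i =>
      { inp, rows, cols, len := ones n, thr := ones (g - i),
        tmp := ones i, thr' := ones i, buf := ones i }) ?_ ?_ (fun i _ => rfl) fun i hi =>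
        (Exec.seq (.push .tmp true _) (.seq (.push .thr' true _) (.push .buf true _))).of_eq
          ?_ le_rfl
    · simp [Store.main]
    · simp
    · simp [Store.get, Store.set, ones_succ]
  have h2 : Exec R (case .tmp (fill false ;; loop .thr' fun _ => expandAll)
        fun _ => clear .tmp ;; clear .thr' ;; fill true)
      { inp, rows, cols, len := ones n, thr := ones g, tmp := ones (g - c), thr' := ones g }
      (.main n g inp rows cols [] (enc (initial c n g)) [] [] [])
      (9 * n + 20 + c * (20 * (n + 1) ^ (c + 2) + 3)) := by
    by_cases hgc : g ≤ c
    · have h3 : Exec R (loop .thr' fun _ => expandAll)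
          { inp, rows, cols, len := ones n, thr := ones g, thr' := ones g,
            fro := true :: List.replicate n false }
          (.main n g inp rows cols [] (enc (initial c n g)) [] [] [])
          (g * (20 * (n + 1) ^ (c + 2) + 2 + 1) + 1) := by
        refine exec_loop_ones g (fun i =>
          { inp, rows, cols, len := ones n, thr := ones g, thr' := ones (g - i), fro :=
              enc ((fun L => L.flatMap (expand n))^[i] [List.replicate n false]) }) ?_ ?_
          (fun i _ => rfl) fun i hi => (exec_expandAll (n := n) _
            (fun v hv => length_of_mem_rounds hv) _ rfl rfl rfl rfl rfl rfl rfl rfl).of_eq ?_ ?_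
        · simp
        · simp [Store.main, initial, hgc]
        · rw [Function.iterate_succ_apply']
          rfl
        · rw [length_rounds]
          -- After `i` rounds there are exactly `n ^ i` candidates, and `i < g ≤ c`.
          have : n ^ i ≤ (n + 1) ^ c := (Nat.pow_le_pow_left (Nat.le_succ n) i).trans
            (Nat.pow_le_pow_right (Nat.succ_pos n) (by omega))
          calc n ^ i * (20 * (n + 1) ^ 2) + 2 ≤ (n + 1) ^ c * (20 * (n + 1) ^ 2) + 2 :=
                Nat.add_le_add_right (Nat.mul_le_mul_right _ this) _
            _ = _ := by ring
      refine (Exec.case_nil (k := .tmp) ?_ (.seq (exec_fill n false _ rfl rfl rfl)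
        (h3.of_start ?_))).of_eq rfl ?_
      · simp [Store.get, Nat.sub_eq_zero_of_le hgc]
      · simp [Store.set, Nat.sub_eq_zero_of_le hgc]
      · have : g * (20 * (n + 1) ^ (c + 2) + 2 + 1) ≤ c * (20 * (n + 1) ^ (c + 2) + 3) :=
          Nat.mul_le_mul_right _ hgc
        omega
    · obtain ⟨m, hm⟩ : ∃ m, g - c = m + 1 := ⟨g - c - 1, by omega⟩
      refine (Exec.case_cons (k := .tmp) (p := fun _ => clear .tmp ;; clear .thr' ;; fill true)
        (b := true) (l := ones m) ?_ (.seq (exec_clear (ones m) _ rfl) (.seq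
          (exec_clear (ones g) _ rfl) (exec_fill n true _ rfl rfl rfl)))).of_eq ?_ ?_
      · simp [Store.get, hm, ones_succ]
      · simp [Store.set, Store.main, initial, hgc]
      · simp only [List.length_replicate]
        omega
  refine (Exec.seq h1 (.seq (exec_move (by decide) (ones g) _ rfl) (.seq
    (exec_dropTmp c g _ rfl) (h2.of_start ?_)))).of_eq rfl ?_
  · simp [Store.set, Store.get]
  · simp only [List.length_replicate]; omega

end Initial

/-! ### One branching pass over the family -/

namespace Mask

/-- A list which is nonempty if the two sets meet. -/
def hits : List Bool → List Bool → List Bool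
  | [], _ => []
  | _ :: _, [] => []
  | v :: vs, b :: bs => hits vs bs ++ if v && b then [true] else []

/-- The programs have no Boolean variables; emptiness of the stacks `hit1` and `hit2` serves as the
flag. -/
theorem hits_eq_nil (v I : List Bool) : hits v I = [] ↔ hit v I = false := by
  induction v generalizing I with
  | nil => simp [hits, hit]
  | cons b v ih =>
    cases I with
    | nil => simp [hits, hit]
    | cons a I => cases h : b && a <;> simp [hits, hit, ih, h]

theorem length_hits_le (v I : List Bool) : (hits v I).length ≤ v.length := by
  induction v generalizing I with
  | nil => simp [hits]
  | cons b v ih =>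
    cases I with
    | nil => simp [hits]
    | cons a I =>
      have := ih I
      cases h : b && a <;> simp [hits, h] <;> omega

theorem del_eq_self {v I : List Bool} (h : hit v I = false) : del v I = v := by
  induction v generalizing I with
  | nil => rfl
  | cons b v ih =>
    cases I with
    | nil => rfl
    | cons a I =>
      simp only [hit, Bool.or_eq_false_iff] at h
      rw [del, ih h.2]
      cases b <;> cases a <;> simp_all

/-- The use of `I.tail` treats an exhausted and a nonempty `I` alike, as the induction along `walk`
requires. -/
theorem del_cons (b : Bool) (v I : List Bool) : del (b :: v) I = del [b] I ++ del v I.tail := by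
  cases I <;> simp [del]

theorem hits_cons (b : Bool) (v I : List Bool) : hits (b :: v) I = hits v I.tail ++ hits [b] I := by
  cases I <;> cases v <;> simp [hits]

theorem length_branch_le (g : ℕ) (I J v : List Bool) : (branch g I J v).length ≤ 2 := by
  refine (List.length_filter_le _ _).trans ?_
  split <;> simp

theorem length_of_mem_branch {g : ℕ} {I J u v : List Bool} (h : u ∈ branch g I J v) :
    u.length = v.length := by
  have := (List.mem_filter.1 h).1
  split at this <;> aesop

end Mask

open Mask

section Pass

variable {R : List Bool → List Bool → ℕ → Prop}

namespace Prog

/-- Compare an entry of a set with the entry of another set on top of the stack `k`. -/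
def compare (k k' d h : Stk) (v : Bool) : Prog :=
  case k (push d v) fun b => push k' b ;; push d (v && !b) ;;
    if v && b then push h true else skip

/-- Compare the set on top of `fro` with the sets on `one` and `two`. -/
def walk : Prog :=
  loop .len fun _ => push .len' true ;; case .fro skip fun v =>
    compare .one .one' .del1 .hit1 v ;; compare .two .two' .del2 .hit2 v

/-- Move the set on `d` to `fro'`, unless it is too small. -/
def emit (d : Stk) : Prog :=
  loop d (fun b => push .buf b ;;
    if b then case .thr skip (fun x => push .thr' x) else skip) ;;
  case .thr (push .fro' true ;; move .buf .fro') (fun x => push .thr x ;; clear .buf) ;;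
  move .thr' .thr

/-- Take a set from `fro` and put the sets of `Mask.branch` on `fro'`. -/
def passRecord : Prog :=
  walk ;; move .len' .len ;; move .one' .one ;; move .two' .two ;;
    case .hit1 (emit .del1 ;; clear .del2 ;; clear .hit2) fun _ =>
      case .hit2 (emit .del2 ;; clear .del1)
        (fun _ => emit .del1 ;; emit .del2 ;; clear .hit2) ;; clear .hit1

/-- Replace each set on `fro` by the sets of `Mask.branch`. -/
def pass : Prog := loop .fro (fun _ => passRecord) ;; move .fro' .fro

end Prog

open Prog

theorem exec_compare_one (v : Bool) (I : List Bool) (s : Store) (hI : s.one = I) :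
    Exec R (compare .one .one' .del1 .hit1 v) s ((((s.set .one I.tail).set .one'
      ((I.take 1).reverse ++ s.one')).set .del1 (del [v] I ++ s.del1)).set .hit1
        (hits [v] I ++ s.hit1)) 4 := by
  cases I with
  | nil =>
    refine (Exec.case_nil (k := .one) hI (.push .del1 v _)).of_eq ?_ (by omega)
    simp [Store.get, Store.set, hits, hI]
  | cons b I =>
    have h1 (s : Store) : Exec R (if v && b then push .hit1 true else skip) s
        (s.set .hit1 (hits [v] [b] ++ s.hit1)) 1 := by
      cases h : v && b
      · exact (Exec.skip _).of_eq (by simp [Store.set, hits, h]) le_rfl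
      · exact (Exec.push .hit1 true _).of_eq (by simp [Store.get, Store.set, hits, h]) le_rfl
    refine (Exec.case_cons (k := .one) (p := fun b => push .one' b ;; push .del1 (v && !b) ;;
      if v && b then push .hit1 true else skip) (b := b) (l := I) hI
      (.seq (.push .one' b _) (.seq (.push .del1 (v && !b) _) (h1 _)))).of_eq ?_ le_rfl
    simp [Store.get, Store.set, hits, del]

theorem exec_compare_two (v : Bool) (I : List Bool) (s : Store) (hI : s.two = I) :
    Exec R (compare .two .two' .del2 .hit2 v) s ((((s.set .two I.tail).set .two'
      ((I.take 1).reverse ++ s.two')).set .del2 (del [v] I ++ s.del2)).set .hit2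
        (hits [v] I ++ s.hit2)) 4 := by
  cases I with
  | nil =>
    refine (Exec.case_nil (k := .two) hI (.push .del2 v _)).of_eq ?_ (by omega)
    simp [Store.get, Store.set, hits, hI]
  | cons b I =>
    have h1 (s : Store) : Exec R (if v && b then push .hit2 true else skip) s
        (s.set .hit2 (hits [v] [b] ++ s.hit2)) 1 := by
      cases h : v && b
      · exact (Exec.skip _).of_eq (by simp [Store.set, hits, h]) le_rfl
      · exact (Exec.push .hit2 true _).of_eq (by simp [Store.get, Store.set, hits, h]) le_rfl
    refine (Exec.case_cons (k := .two) (p := fun b => push .two' b ;; push .del2 (v && !b) ;;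
      if v && b then push .hit2 true else skip) (b := b) (l := I) hI
      (.seq (.push .two' b _) (.seq (.push .del2 (v && !b) _) (h1 _)))).of_eq ?_ le_rfl
    simp [Store.get, Store.set, hits, del]

theorem reverse_take_succ (I : List Bool) (m : ℕ) :
    (I.take (m + 1)).reverse = (I.tail.take m).reverse ++ (I.take 1).reverse := by
  cases I <;> simp

theorem exec_walk (v rest I J : List Bool) (m : ℕ) (s : Store) (hn : s.len = ones v.length)
    (hm : s.len' = ones m) (hv : s.fro = v ++ rest) (hI : s.one = I) (hJ : s.two = J) :
    Exec R walk s (((((((((((s.set .len []).set .len' (ones (v.length + m))).set .fro rest).set .one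
      (I.drop v.length)).set .two (J.drop v.length)).set .one'
      ((I.take v.length).reverse ++ s.one')).set .two' ((J.take v.length).reverse ++ s.two')).set
      .del1 ((del v I).reverse ++ s.del1)).set .del2 ((del v J).reverse ++ s.del2)).set
      .hit1 (hits v I ++ s.hit1)).set .hit2 (hits v J ++ s.hit2)) (11 * v.length + 1) := by
  induction v generalizing s m I J with
  | nil =>
    refine (Exec.loop_nil (k := .len) hn).of_eq ?_ (by simp)
    simp only [List.length_nil] at hn
    simp [Store.ext_iff, Store.set, hn, hm, hv, hI, hJ, del, hits]
  | cons v vs ih =>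
    refine (Exec.loop_cons (k := .len) (b := true) (l := ones vs.length) hn
      (.seq (.push .len' true _) (.case_cons (k := .fro)
        (p := fun v => compare .one .one' .del1 .hit1 v ;; compare .two .two' .del2 .hit2 v)
        (b := v) (l := vs ++ rest) (by exact hv) (.seq (exec_compare_one v I _ (by exact hI))
          (exec_compare_two v J _ (by exact hJ)))))
      (ih I.tail J.tail (m + 1) _ (by rfl) (by simp [Store.get, Store.set, hm, ones_succ])
        (by rfl) (by rfl) (by rfl))).of_eq ?_ ?_
    · rw [del_cons v vs I, del_cons v vs J, hits_cons v vs I, hits_cons v vs J, List.length_cons,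
        reverse_take_succ I vs.length, reverse_take_succ J vs.length]
      have h1 : ∀ I, (del [v] I).reverse = del [v] I := by
        intro I; cases I <;> rfl
      have h2 : vs.length + (m + 1) = vs.length + 1 + m := by omega
      simp [Store.get, Store.set, h1, h2]
    · rw [List.length_cons]; omega

/-- Every element of the set uses up one unit of the threshold, so `thr` ends empty exactly if the
set is large enough. The units used are kept on `thr'`, from which `emit` restores the threshold. -/
theorem exec_emit_loop {d : Stk} (hd : d = .del1 ∨ d = .del2) (l : List Bool) (a m : ℕ)
    (s : Store) (hl : s.get d = l) (ha : s.thr = ones a) (hm : s.thr' = ones m) :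
    Exec R (loop d fun b => push .buf b ;;
      if b then case .thr skip (fun x => push .thr' x) else skip) s
      ((((s.set d []).set .buf (l.reverse ++ s.buf)).set .thr (ones (a - l.count true))).set .thr'
        (ones (min a (l.count true) + m))) (4 * l.length + 1) := by
  induction l generalizing s a m with
  | nil =>
    refine (Exec.loop_nil hl).of_eq ?_ (by simp)
    rcases hd with rfl | rfl <;> simp only [Store.get] at hl <;>
      simp [Store.ext_iff, Store.set, hl, ha, hm]
  | cons b l ih =>
    cases b with
    | false =>
      refine (Exec.loop_cons hl (.seq (.push .buf false _) (.skip _)) (ih a m _ ?_ ?_ ?_)).of_eq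
        ?_ ?_
      · rcases hd with rfl | rfl <;> rfl
      · rcases hd with rfl | rfl <;> simpa [Store.get, Store.set] using ha
      · rcases hd with rfl | rfl <;> simpa [Store.get, Store.set] using hm
      · rcases hd with rfl | rfl <;> simp [Store.get, Store.set]
      · rw [List.length_cons]; omega
    | true =>
      cases a with
      | zero =>
        refine (Exec.loop_cons hl (.seq (.push .buf true _) (.case_nil (k := .thr) ?_ (.skip _)))
          (ih 0 m _ ?_ ?_ ?_)).of_eq ?_ ?_
        · rcases hd with rfl | rfl <;> simpa [Store.get, Store.set] using ha
        · rcases hd with rfl | rfl <;> rfl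
        · rcases hd with rfl | rfl <;> simpa [Store.get, Store.set] using ha
        · rcases hd with rfl | rfl <;> simpa [Store.get, Store.set] using hm
        · rcases hd with rfl | rfl <;> simp [Store.get, Store.set]
        · rw [List.length_cons]; omega
      | succ a =>
        refine (Exec.loop_cons hl (.seq (.push .buf true _) (.case_cons (k := .thr)
          (p := fun x => push .thr' x) (b := true) (l := ones a) ?_ (.push .thr' true _)))
          (ih a (m + 1) _ ?_ ?_ ?_)).of_eq ?_ ?_
        · rcases hd with rfl | rfl <;> simpa [Store.get, Store.set, ones_succ] using ha
        · rcases hd with rfl | rfl <;> rfl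
        · rcases hd with rfl | rfl <;> rfl
        · rcases hd with rfl | rfl <;> simp [Store.get, Store.set, hm, ones_succ]
        · rcases hd with rfl | rfl <;>
          · simp [Store.get, Store.set]
            omega
        · rw [List.length_cons]; omega

theorem exec_emit {d : Stk} (hd : d = .del1 ∨ d = .del2) (u : List Bool) (g : ℕ) (s : Store)
    (hl : s.get d = u.reverse) (hg : s.thr = ones g) (hg' : s.thr' = []) (hb : s.buf = []) :
    Exec R (emit d) s ((s.set d []).set .fro'
      ((enc ([u].filter fun u => g ≤ u.count true)).reverse ++ s.fro')) (8 * u.length + 5) := by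
  have h1 := exec_emit_loop (R := R) hd u.reverse g 0 s hl hg hg'
  simp only [List.count_reverse, List.length_reverse, List.reverse_reverse, hb, List.append_nil,
    add_zero] at h1
  have h2 : Exec R (case .thr (push .fro' true ;; move .buf .fro')
      (fun x => push .thr x ;; clear .buf)) ((((s.set d []).set .buf u).set .thr
        (ones (g - u.count true))).set .thr' (ones (min g (u.count true))))
      ((((s.set d []).set .thr (ones (g - u.count true))).set .thr'
        (ones (min g (u.count true)))).set .fro'
        ((enc ([u].filter fun u => g ≤ u.count true)).reverse ++ s.fro')) (2 * u.length + 3) := by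
    by_cases h : g ≤ u.count true
    · refine (Exec.case_nil (k := .thr) (by simp [Nat.sub_eq_zero_of_le h, Store.get, Store.set])
        (.seq (.push .fro' true _) (exec_move (by decide) u _
          (by simp [Store.get, Store.set])))).of_eq ?_ (by omega)
      rcases hd with rfl | rfl <;> simp [Store.get, Store.set, h, hb]
    · obtain ⟨m, hm⟩ : ∃ m, g - u.count true = m + 1 := ⟨g - u.count true - 1, by omega⟩
      refine (Exec.case_cons (k := .thr) (p := fun x => push .thr x ;; clear .buf) (b := true)
        (l := ones m) (by simp [hm, Store.get, Store.set, ones_succ])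
        (.seq (.push .thr true _) (exec_clear u _ (by simp [Store.get, Store.set])))).of_eq
          ?_ (by omega)
      rcases hd with rfl | rfl <;> simp [Store.get, Store.set, h, hb, hm, ones_succ]
  refine (Exec.seq h1 (.seq h2 (exec_move (by decide) (ones (min g (u.count true))) _
    (by simp [Store.get, Store.set])))).of_eq ?_ ?_
  · have : min g (u.count true) + (g - u.count true) = g := by omega
    rcases hd with rfl | rfl <;> simp [Store.get, Store.set, hg, hg', this]
  · have := u.count_le_length (a := true)
    simp only [List.length_replicate]
    omega

theorem exec_passRecord (n g : ℕ) (v rest I J inp rows cols cols' fro' : List Bool)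
    (hn : v.length = n) :
    Exec R passRecord (.main n g inp rows cols cols' (v ++ rest) fro' I J)
      (.main n g inp rows cols cols' rest ((enc (branch g I J v)).reverse ++ fro') I J)
      (40 * n + 20) := by
  subst hn
  have h1 : Exec R (case .hit1 (emit .del1 ;; clear .del2 ;; clear .hit2) fun _ =>
      case .hit2 (emit .del2 ;; clear .del1)
        (fun _ => emit .del1 ;; emit .del2 ;; clear .hit2) ;; clear .hit1)
      { inp, rows, cols, cols', fro := rest, fro', one := I, two := J, len := ones v.length,
        thr := ones g, del1 := (del v I).reverse, del2 := (del v J).reverse, hit1 := hits v I,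
        hit2 := hits v J }
      (.main v.length g inp rows cols cols' rest ((enc (branch g I J v)).reverse ++ fro') I J)
      (20 * v.length + 15) := by
    have l1 := length_hits_le v I
    have l2 := length_hits_le v J
    -- If `v` misses `I`, then `del v I = v`, so `del1` already holds the unchanged set. If `v`
    -- meets `I` but misses `J`, the same is true of `del2`. Only if it meets both are both stacks
    -- emitted.
    cases e1 : hits v I with
    | nil =>
      have e1' := (hits_eq_nil v I).1 e1
      refine (Exec.case_nil (k := .hit1) rfl (.seq (exec_emit (.inl rfl) v g _
        (by simp [Store.get, del_eq_self e1']) rfl rfl rfl) (.seq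
        (exec_clear (del v J).reverse _ rfl) (exec_clear (hits v J) _ rfl)))).of_eq ?_ ?_
      · simp [Store.main, Store.set, branch, e1']
      · simp only [List.length_reverse, length_del]; omega
    | cons a1 r1 =>
      have e1' : hit v I = true := by
        rw [← Bool.not_eq_false, ← hits_eq_nil, e1]; simp
      rw [e1, List.length_cons] at l1
      cases e2 : hits v J with
      | nil =>
        have e2' := (hits_eq_nil v J).1 e2
        refine (Exec.case_cons (k := .hit1) (b := a1) (l := r1)
          (p := fun _ => case .hit2 (emit .del2 ;; clear .del1)
            (fun _ => emit .del1 ;; emit .del2 ;; clear .hit2) ;; clear .hit1) rfl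
          (.seq (.case_nil (k := .hit2) rfl (.seq (exec_emit (.inr rfl) v g _
            (by simp [Store.get, Store.set, del_eq_self e2']) rfl rfl rfl)
            (exec_clear (del v I).reverse _ rfl))) (exec_clear r1 _ rfl))).of_eq ?_ ?_
        · simp [Store.main, Store.set, branch, e2']
        · simp only [List.length_reverse, length_del]; omega
      | cons a2 r2 =>
        have e2' : hit v J = true := by
          rw [← Bool.not_eq_false, ← hits_eq_nil, e2]; simp
        rw [e2, List.length_cons] at l2
        refine (Exec.case_cons (k := .hit1) (b := a1) (l := r1)
          (p := fun _ => case .hit2 (emit .del2 ;; clear .del1)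
            (fun _ => emit .del1 ;; emit .del2 ;; clear .hit2) ;; clear .hit1) rfl
          (.seq (.case_cons (k := .hit2) (b := a2) (l := r2)
            (p := fun _ => emit .del1 ;; emit .del2 ;; clear .hit2) rfl
            (.seq (exec_emit (.inl rfl) (del v I) g _ rfl rfl rfl rfl)
            (.seq (exec_emit (.inr rfl) (del v J) g _ rfl rfl rfl rfl)
            (exec_clear r2 _ rfl)))) (exec_clear r1 _ rfl))).of_eq ?_ ?_
        · have h : branch g I J v = ([del v I].filter fun u => g ≤ u.count true) ++
              [del v J].filter fun u => g ≤ u.count true := by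
            rw [← List.filter_append, branch, e1', e2']
            rfl
          rw [h, enc_append, List.reverse_append, List.append_assoc]
          rfl
        · simp only [length_del]; omega
  refine (Exec.seq (exec_walk v rest I J 0 _ rfl rfl rfl rfl rfl) (.seq
    (exec_move (by decide) (ones v.length) _ rfl) (.seq
    (exec_move (by decide) (I.take v.length).reverse _ (by simp [Store.get, Store.set, Store.main]))
    (.seq (exec_move (by decide) (J.take v.length).reverse _
      (by simp [Store.get, Store.set, Store.main]))
    (h1.of_start ?_))))).of_eq rfl ?_
  · simp [Store.get, Store.set, Store.main]
  · simp only [List.length_reverse, List.length_take, List.length_replicate]; omega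

theorem exec_pass_loop (n g : ℕ) (L : List (List Bool)) (hL : ∀ v ∈ L, v.length = n)
    (I J inp rows cols cols' fro' : List Bool) :
    Exec R (loop .fro fun _ => passRecord) (.main n g inp rows cols cols' (enc L) fro' I J)
      (.main n g inp rows cols cols' [] ((enc (L.flatMap (branch g I J))).reverse ++ fro') I J)
      (L.length * (40 * n + 21) + 1) := by
  induction L generalizing fro' with
  | nil => exact (Exec.loop_nil (k := .fro) rfl).of_eq (by simp) (by simp)
  | cons v L ih =>
    refine (Exec.loop_cons (k := .fro) (b := true) (l := v ++ enc L) rfl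
      (exec_passRecord n g v (enc L) I J inp rows cols cols' fro' (hL v (by simp)))
      (ih (fun u hu => hL u (List.mem_cons_of_mem _ hu)) _)).of_eq ?_ ?_
    · simp
    · simp only [List.length_cons, add_mul, one_mul]; omega

theorem exec_pass (n g : ℕ) (L : List (List Bool)) (hL : ∀ v ∈ L, v.length = n)
    (I J inp rows cols cols' : List Bool) :
    Exec R pass (.main n g inp rows cols cols' (enc L) [] I J)
      (.main n g inp rows cols cols' (enc (L.flatMap (branch g I J))) [] I J)
      (45 * (n + 1) * (L.length + 1)) := by
  refine (Exec.seq (exec_pass_loop n g L hL I J inp rows cols cols' []) (exec_move (by decide)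
    (enc (L.flatMap (branch g I J))).reverse _ (by simp [Store.main, Store.get]))).of_eq ?_ ?_
  · simp [Store.main, Store.get, Store.set]
  · have h1 : ∀ u ∈ L.flatMap (branch g I J), u.length = n := by
      intro u hu
      obtain ⟨v, hv, hu⟩ := List.mem_flatMap.1 hu
      rw [length_of_mem_branch hu, hL v hv]
    -- A single pass at most doubles the family, which suffices for its own cost; that doublings do
    -- not accumulate is the matter of `Good`.
    have h2 : (L.flatMap (branch g I J)).length ≤ 2 * L.length := by
      rw [List.length_flatMap]
      refine (List.sum_le_card_nsmul _ 2 ?_).trans ?_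
      · simp only [List.mem_map]
        rintro _ ⟨v, -, rfl⟩
        exact length_branch_le g I J v
      · simp [mul_comm]
    rw [List.length_reverse, length_enc h1]
    have h3 := Nat.mul_le_mul_right (n + 1) h2
    nlinarith [Nat.zero_le (L.length * n), Nat.zero_le L.length]

end Pass

/-! ### Processing the adjacency matrix and answering -/

section Rows

variable {R : List Bool → List Bool → ℕ → Prop}

namespace Prog

/-- Process a row of the adjacency matrix. -/
def processRow : Prog :=
  push .two true ;;
    loop .cols (fun _ => push .cols' true ;;
      case .inp skip (fun b => if b then skip else pass) ;; push .two false) ;;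
    move .cols' .cols ;; clear .two

/-- Process the adjacency matrix. -/
def processRows : Prog := push .one true ;; loop .rows fun _ => processRow ;; push .one false

/-- Answer whether `fro` is nonempty, and empty all stacks. -/
def finish : Prog :=
  case .fro (push .out false) (fun _ => push .out true ;; clear .fro) ;;
    clear .len ;; clear .cols ;; clear .one ;; clear .thr

end Prog

open Prog

/-- The potential argument enters the running time here: `Good` persists through every pass, so each
pass starts with at most `W` candidates and all entries have the same cost bound. -/
theorem exec_processRow_loop {n g W : ℕ} (i j : ℕ) (r rest : List Bool) (L : List (List Bool))
    (hL : Good n g W L) (rows : List Bool) :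
    Exec R (loop .cols fun _ => push .cols' true ;;
      case .inp skip (fun b => if b then skip else pass) ;; push .two false)
      (.main n g (r ++ rest) rows (ones r.length) (ones j) (enc L) [] (single i) (single j))
      (.main n g rest rows [] (ones (r.length + j)) (enc (Mask.processRow g i j r L)) [] (single i)
        (single (r.length + j)))
      (r.length * (45 * (n + 1) * (W + 1) + 4) + 1) := by
  induction r generalizing j L with
  | nil => exact (Exec.loop_nil (k := .cols) rfl).of_eq (by simp [Mask.processRow]) (by simp)
  | cons b r ih =>
    have hL' : Good n g W (if b then L else L.flatMap (branch g (single i) (single j))) := by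
      split
      · exact hL
      · exact hL.flatMap_branch i j
    have h1 : Exec R (if b then skip else pass)
        (.main n g (r ++ rest) rows (ones r.length) (ones (j + 1)) (enc L) [] (single i)
          (single j))
        (.main n g (r ++ rest) rows (ones r.length) (ones (j + 1))
          (enc (if b then L else L.flatMap (branch g (single i) (single j)))) [] (single i)
          (single j)) (45 * (n + 1) * (W + 1)) := by
      cases b
      · exact (exec_pass n g L hL.length_eq _ _ _ _ _ _).weaken
          (Nat.mul_le_mul_left _ (Nat.succ_le_succ hL.length_le))
      · exact (Exec.skip _).weaken (Nat.mul_pos (by omega) (by omega))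
    refine (Exec.loop_cons (k := .cols) (b := true) (l := ones r.length) rfl
      (.seq (.push .cols' true _) (.seq (.case_cons (k := .inp)
        (p := fun b => if b then skip else pass) (b := b) (l := r ++ rest) rfl (h1.of_start ?_))
        (.push .two false _))) ((ih (j + 1) _ hL').of_start ?_)).of_eq ?_ ?_
    · simp [Store.main, Store.get, Store.set, ones_succ]
    · simp [Store.main, Store.get, Store.set, single_succ]
    · rw [List.length_cons, Mask.processRow, show r.length + (j + 1) = r.length + 1 + j by omega]
    · simp only [List.length_cons, add_mul, one_mul]; omega

theorem exec_processRow {n g W : ℕ} (i : ℕ) (r rest : List Bool) (hr : r.length = n)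
    (L : List (List Bool)) (hL : Good n g W L) (rows : List Bool) :
    Exec R Prog.processRow
      (.main n g (r ++ rest) rows (ones n) [] (enc L) [] (single i) [])
      (.main n g rest rows (ones n) [] (enc (Mask.processRow g i 0 r L)) [] (single i) [])
      (n * (45 * (n + 1) * (W + 1) + 8) + 6) := by
  have h1 := exec_processRow_loop (R := R) i 0 r rest L hL rows
  rw [hr] at h1
  refine (Exec.seq (.push .two true _) (.seq (h1.of_start ?_) (.seq
    (exec_move (by decide) (ones n) _ (by simp [Store.main, Store.get]))
    (exec_clear (single n) _ (by simp [Store.main, Store.get, Store.set]))))).of_eq ?_ ?_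
  · simp [Store.main, Store.get, Store.set]
  · simp [Store.main, Store.get, Store.set]
  · simp [single, mul_add]
    omega

theorem exec_processRows_loop {n g W : ℕ} (i : ℕ) (rs : List (List Bool))
    (hr : ∀ r ∈ rs, r.length = n) (L : List (List Bool)) (hL : Good n g W L) :
    Exec R (loop .rows fun _ => Prog.processRow ;; push .one false)
      (.main n g rs.flatten (ones rs.length) (ones n) [] (enc L) [] (single i) [])
      (.main n g [] [] (ones n) [] (enc (Mask.processRows g i rs L)) []
        (single (rs.length + i)) [])
      (rs.length * (n * (45 * (n + 1) * (W + 1) + 8) + 8) + 1) := by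
  induction rs generalizing i L with
  | nil => exact (Exec.loop_nil (k := .rows) rfl).of_eq (by simp [Mask.processRows]) (by simp)
  | cons r rs ih =>
    refine (Exec.loop_cons (k := .rows) (b := true) (l := ones rs.length) rfl
      (.seq (exec_processRow i r rs.flatten (hr r (by simp)) L hL (ones rs.length))
        (.push .one false _)) ((ih (i + 1) (fun u hu => hr u (List.mem_cons_of_mem _ hu)) _
          (hL.processRow i 0 r)).of_start ?_)).of_eq ?_ ?_
    · simp [Store.main, Store.get, Store.set, single_succ]
    · rw [List.length_cons, Mask.processRows, show rs.length + (i + 1) = rs.length + 1 + i by omega]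
    · simp only [List.length_cons, add_mul, one_mul]; omega

theorem exec_processRows {n g W : ℕ} (rs : List (List Bool)) (hn : rs.length = n)
    (hr : ∀ r ∈ rs, r.length = n) (L : List (List Bool)) (hL : Good n g W L) :
    Exec R Prog.processRows
      (.main n g rs.flatten (ones n) (ones n) [] (enc L) [] [] [])
      (.main n g [] [] (ones n) [] (enc (Mask.processRows g 0 rs L)) [] (single n) [])
      (n * (n * (45 * (n + 1) * (W + 1) + 8) + 8) + 2) := by
  have h1 := exec_processRows_loop (R := R) 0 rs hr L hL
  rw [hn] at h1
  refine (Exec.seq (.push .one true _) (h1.of_start ?_)).of_eq ?_ (by omega)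
  · simp [Store.main, Store.get, Store.set]
  · simp

/-- The remaining stacks are emptied because `haltList` allows contents on the output stack only.
Clearing the family is affordable since it occupies at most `W * (n + 1)` cells. -/
theorem exec_finish {n g W : ℕ} (hg : g ≤ n + 1) (L : List (List Bool)) (hL : Good n g W L) :
    Exec R finish (.main n g [] [] (ones n) [] (enc L) [] (single n) [])
      { out := [decide (L ≠ [])] } (2 * (n + 1) * (W + 1) + 8 * n + 20) := by
  cases L with
  | nil =>
    refine (Exec.seq (.case_nil (k := .fro) rfl (.push .out false _)) (.seq
      (exec_clear (ones n) _ rfl) (.seq (exec_clear (ones n) _ rfl)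
      (.seq (exec_clear (single n) _ rfl) (exec_clear (ones g) _ rfl))))).of_eq ?_ ?_
    · simp [Store.main, Store.get, Store.set]
    · simp [single]
      omega
  | cons v L =>
    refine (Exec.seq (.case_cons (k := .fro) (b := true) (l := v ++ enc L)
      (p := fun _ => push .out true ;; clear .fro) rfl
      (.seq (.push .out true _) (exec_clear (v ++ enc L) _ rfl))) (.seq
      (exec_clear (ones n) _ rfl) (.seq (exec_clear (ones n) _ rfl)
      (.seq (exec_clear (single n) _ rfl) (exec_clear (ones g) _ rfl))))).of_eq ?_ ?_
    · simp [Store.main, Store.get, Store.set]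
    · have h1 := length_enc hL.length_eq
      have h2 := Nat.mul_le_mul_right (n + 1) hL.length_le
      rw [enc_cons, List.length_cons] at h1
      simp only [single, List.length_append, List.length_replicate, List.length_singleton] at h1 ⊢
      nlinarith

end Rows

/-! ### Assembly: the logarithmic bound, the total running time and the theorem -/

open Mask

/-- The constant in the definition of a constant-log-bounded function, made uniform. -/
theorem ConstantLogBounded.exists_forall {f : ℕ → ℕ} (hf : ConstantLogBounded f) :
    ∃ c : ℕ, ∀ n, f n ≤ c ∨ (n : ℝ) - c * Real.logb 2 n ≤ f n := by
  obtain ⟨c, hc⟩ := hf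
  obtain ⟨N, hN⟩ := eventually_atTop.1 hc
  -- The finitely many exceptional values of `f` are absorbed into the constant. Enlarging `c` only
  -- weakens the second alternative, because `Real.logb 2 n` is nonnegative, with value `0` at `n =
  -- 0`.
  refine ⟨max c ((Finset.range N).sup f), fun n => ?_⟩
  by_cases hn : N ≤ n
  · refine (hN n hn).imp (fun h => h.trans (le_max_left _ _)) fun h => le_trans ?_ h
    have h1 : 0 ≤ Real.logb 2 n := by
      rcases Nat.eq_zero_or_pos n with rfl | h
      · simp
      · exact Real.logb_nonneg one_lt_two (by exact_mod_cast h)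
    have h2 : (c : ℝ) ≤ (max c ((Finset.range N).sup f) : ℕ) := by
      exact_mod_cast le_max_left _ _
    have := mul_le_mul_of_nonneg_right h2 h1
    linarith
  · exact .inl ((Finset.le_sup (f := f) (Finset.mem_range.2 (not_le.1 hn))).trans
      (le_max_right _ _))

theorem two_pow_sub_le {c n g : ℕ} (hn : 0 < n) (hg : g ≤ n)
    (h : (n : ℝ) - c * Real.logb 2 n ≤ g) : 2 ^ (n - g) ≤ n ^ c := by
  have hn' : (0 : ℝ) < n := by exact_mod_cast hn
  have h1 : ((n - g : ℕ) : ℝ) ≤ Real.logb 2 ((n : ℝ) ^ c) := by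
    rw [Real.logb_pow, Nat.cast_sub hg]
    linarith
  rw [Real.le_logb_iff_rpow_le one_lt_two (by positivity), Real.rpow_natCast] at h1
  exact_mod_cast h1

/-- If `f n > n`, both thresholds `f n` and `n + 1` are out of reach for subsets of `Fin n`;
otherwise they agree with the truncated one. -/
theorem ramseyMem_fin_iff {f : ℕ → ℕ} {n : ℕ} (c : ℕ) (rel : Fin n → Fin n → Bool) :
    RamseyMem f (Fin n) (fun a b => rel a b = true) ↔
      survivors c n (min (f n) (n + 1))
        ((List.finRange n).map fun i => (List.finRange n).map fun j => rel i j) ≠ [] := by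
  rw [survivors_ne_nil_iff]
  refine exists_congr fun A => and_congr_left fun _ => ?_
  have := A.card_le_univ
  rw [Fintype.card_fin] at this
  simp only [IsLarge, Fintype.card_fin]
  omega

/-- A program which decides the Ramsey quantifier of `f`, given a machine which computes `f`. -/
def Prog.ramsey (c : ℕ) : Prog :=
  readHeader ;; call ;; decode ;; initFrontier c ;; pass ;; processRows ;; finish

/-- The time that the program takes, where `Q` is the time of the machine which computes `f`. -/
noncomputable def ramseyTime (c D : ℕ) (Q : Polynomial ℕ) : Polynomial ℕ :=
  let X := Polynomial.X
  let Y := X + Polynomial.C D * Q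
  let W := (X + 1) ^ c
  (6 * X + 6 * X + 8) + (Q + X + Y + 2) + (Y * (15 * X + 21) + 1) +
    (20 * X + Polynomial.C (2 * c + 30) + Polynomial.C c * (20 * (X + 1) ^ (c + 2) + 3)) +
    45 * (X + 1) * (W + 1) + (X * (X * (45 * (X + 1) * (W + 1) + 8) + 8) + 2) +
    (2 * (X + 1) * (W + 1) + 8 * X + 20)

theorem exec_ramsey {R : List Bool → List Bool → ℕ → Prop} {c D n F : ℕ} {Q : Polynomial ℕ}
    {y : List Bool} (hy : y = Computability.encodeNat F) (hR : R (ones n) y (Q.eval n))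
    (hD : y.length ≤ n + D * Q.eval n)
    (hF : F ≤ c ∨ (n : ℝ) - c * Real.logb 2 n ≤ F) (rs : List (List Bool)) (hn : rs.length = n)
    (hr : ∀ r ∈ rs, r.length = n) :
    Exec R (.ramsey c) { inp := ones n ++ false :: rs.flatten }
      { out := [decide (survivors c n (min F (n + 1)) rs ≠ [])] }
      ((ramseyTime c D Q).eval (ones n ++ false :: rs.flatten).length) := by
  set g := min F (n + 1) with hg
  have hgn : g ≤ n + 1 := min_le_right _ _
  have hW1 : 1 ≤ (n + 1) ^ c := Nat.one_le_pow _ _ (Nat.succ_pos n)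
  have hW2 : g ≤ c → n ^ g ≤ (n + 1) ^ c := fun h =>
    (Nat.pow_le_pow_left (Nat.le_succ n) g).trans (Nat.pow_le_pow_right (Nat.succ_pos n) h)
  have hL : Good n g ((n + 1) ^ c) ((initial c n g).flatMap (branch g [] [])) := by
    refine good_filter_initial hW2 fun h h' => ?_
    -- Since `g ≤ n`, the truncation at `n + 1` was not effective. As also `c < g`, the hypothesis
    -- on `F` leaves only the logarithmic alternative, and `n` is positive.
    have hgF : g = F := by omega
    have h1 := two_pow_sub_le (by omega) h' (hgF ▸ hF.resolve_left (hgF ▸ h))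
    exact h1.trans (Nat.pow_le_pow_left (Nat.le_succ n) c)
  -- The initial family is counted directly, since `Good` holds only once the size filter has been
  -- applied.
  have hL0 : (initial c n g).length ≤ (n + 1) ^ c := by
    unfold initial
    split
    · rw [length_rounds]; exact hW2 ‹_›
    · simpa using hW1
  have hdec : (y.reverse.foldl (fun a b => min (2 * a + b.toNat) (n + 1)) 0) = g := by
    rw [hy, foldl_reverse_encodeNat_min]
  refine (Exec.seq (exec_readHeader n rs.flatten) (.seq
    (.call hR (by simp [Store.get]) rfl) (.seq
    (exec_decode n y.reverse 0 (Nat.zero_le _) _ rfl rfl rfl rfl rfl)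
    (.seq ((exec_initFrontier c n g hgn rs.flatten (ones n) (ones n)).of_start ?_)
    -- With both `one` and `two` empty nothing is split, so this pass is the bare size filter.
    (.seq (exec_pass n g _ (fun v hv => length_of_mem_initial hv) [] [] _ _ _ _)
    (.seq (exec_processRows rs hn hr _ hL)
    (exec_finish hgn _ (hL.processRows 0 rs)))))))).of_eq rfl ?_
  · simp [Store.main, Store.set, hdec]
  · have h1 : n ≤ (ones n ++ false :: rs.flatten).length := by simp
    have h2 : rs.flatten.length ≤ (ones n ++ false :: rs.flatten).length := by simp; omega
    have h3 := Q.eval_mono_nat h1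
    generalize (ones n ++ false :: rs.flatten).length = N at h1 h2 h3 ⊢
    have h4 : y.length ≤ N + D * Q.eval N :=
      hD.trans (Nat.add_le_add h1 (Nat.mul_le_mul_left D h3))
    have h5 : (n + 1) ^ c ≤ (N + 1) ^ c := Nat.pow_le_pow_left (by omega) c
    have h6 := hL0.trans h5
    have e : (ramseyTime c D Q).eval N =
      (6 * N + 6 * N + 8) + ((Q.eval N + N + (N + D * Q.eval N) + 2) +
        ((N + D * Q.eval N) * (15 * N + 21) + 1 + (20 * N + 2 * c + 30 +
          c * (20 * (N + 1) ^ (c + 2) + 3) + (45 * (N + 1) * ((N + 1) ^ c + 1) +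
          ((N * (N * (45 * (N + 1) * ((N + 1) ^ c + 1) + 8) + 8) + 2) +
          (2 * (N + 1) * ((N + 1) ^ c + 1) + 8 * N + 20)))))) := by
      simp only [ramseyTime, Polynomial.eval_add, Polynomial.eval_mul, Polynomial.eval_pow,
        Polynomial.eval_X, Polynomial.eval_C, Polynomial.eval_one, Polynomial.eval_ofNat]
      ring
    rw [e, List.length_reverse, List.length_replicate]
    gcongr

theorem FiniteModel.encode_eq (A : FiniteModel) :
    A.encode = ones A.size ++ false :: ((List.finRange A.size).map fun i =>
      (List.finRange A.size).map fun j => A.rel i j).flatten := by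
  rw [FiniteModel.encode, unaryEncodeNat_eq_replicate, List.flatMap_def]

theorem mainTheorem5 (f : ℕ → ℕ) (hpoly : PolyTimeComputableFun f)
    (hclb : ConstantLogBounded f) : (ramseyQuantifier f).PolyTimeComputable := by
  obtain ⟨h⟩ := hpoly
  obtain ⟨c, hc⟩ := hclb.exists_forall
  obtain ⟨D, hD⟩ := CallRel.exists_length_le h.toTM2ComputableAux
  refine Prog.computableInPolyTime h.toTM2ComputableAux (.ramsey c) _ _ _ (ramseyTime c D h.time)
    fun A => ?_
  have hR : CallRel h.toTM2ComputableAux (ones A.size) (Computability.encodeNat (f A.size))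
      (h.time.eval A.size) := by
    have := h.outputsFun A.size
    rw [unaryEncodeNat_eq_replicate, List.length_replicate] at this
    exact ⟨this⟩
  have hlen := hD _ _ _ hR
  rw [List.length_replicate] at hlen
  have := exec_ramsey rfl hR hlen (hc A.size) ((List.finRange A.size).map fun i =>
    (List.finRange A.size).map fun j => A.rel i j) (by simp) (by simp)
  rw [← A.encode_eq] at this
  refine this.of_eq ?_ le_rfl
  simp only [Computability.encodeBool]
  congr 2
  exact decide_eq_decide.2 (ramseyMem_fin_iff c A.rel).symm
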